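/- For $\alpha>0$ and real $z$ put $$M_\alpha(z)=\frac1{\Gamma(\alpha)}\int_0^\infty e^{-x^2}x^{\alpha-1}e^{xz}\,dx ,$$ and for $\beta>0$, $r\ge 0$ and real $z$ put $$K_\beta(r,z)=\sum_{k=0}^\infty \frac{He_k(z)\,(-r)^k}{\Gamma(\beta+k/2)\,k!},\qquad He_k(z)=(-1)^k\frac{\varphi^{(k)}(z)}{\varphi(z)},\qquad \varphi(z)=\frac{e^{-z^2/2}}{\sqrt{2\pi}} .$$ The integral and the series converge absolutely, and $$M_\alpha(z)=\frac1{2\Gamma(\alpha)}\sum_{k=0}^\infty\Gamma\Big(\frac{\alpha+k}2\Big)\frac{z^k}{k!} =\frac1{2\Gamma(\alpha)}\Big(\Gamma\Big(\frac\alpha2\Big)\,{}_1F_1\Big(\frac\alpha2,\frac12,\frac{z^2}4\Big)+\Gamma\Big(\frac{\alpha+1}2\Big)\,z\;{}_1F_1\Big(\frac{\alpha+1}2,\frac32,\frac{z^2}4\Big)\Big).$$ Let $n\ge 2$, let $X_1,\dots,X_n$ be real random variables on a probability space, and put $\overline X=\frac1n\sum_{i=1}^nX_i$ and $Q=\sum_{i=1}^n(X_i-\overline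 X)^2$. (a) If $X_1,\dots,X_n$ are i.i.d. with the gamma density $x^{\alpha-1}e^{-x}/\Gamma(\alpha)$, $x>0$, for some $\alpha>0$, then $\Pr\{Q\le x\}=0$ for $x\le 0$, and for every $x>0$ $$\Pr\{Q\le x\}=x^{\alpha n/2}\int_{-\infty}^\infty K_{\alpha n/2+1}\big(\sqrt{nx/2},z\big)\,\big(M_\alpha(\sqrt{2/n}\,z)\big)^n\,\varphi(z)\,dz ,$$ where the integral is absolutely convergent. (b) If $X_1,\dots,X_n$ are independent and $X_j$ has the gamma density $x^{\alpha_j-1}e^{-x}/\Gamma(\alpha_j)$, $x>0$, for some $\alpha_j>0$, $j=1,\dots,n$, then, with $\alpha=\sum_{j=1}^n\alpha_j$, $\Pr\{Q\le x\}=0$ for $x\le 0$, and for every $x>0$ $$\Pr\{Q\le x\}=x^{\alpha/2}\int_{-\infty}^\infty K_{\alpha/2+1}\big(\sqrt{nx/2},z\big)\,\Big(\prod_{j=1}^nM_{\alpha_j}(\sqrt{2/n}\,z)\Big)\,\varphi(z)\,dz ,$$ where the integral is absolutely convergent. -/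

import Mathlib

open MeasureTheory ProbabilityTheory
open scoped Nat

noncomputable section

/-- The function `M_α(z) = Γ(α)⁻¹ ∫₀^∞ exp(-x²) x^(α-1) exp(x z) dx`, for real `z`. -/
def gammaM (α z : ℝ) : ℝ :=
  (Real.Gamma α)⁻¹ *
    ∫ x in Set.Ioi (0 : ℝ), Real.exp (-x ^ 2) * x ^ (α - 1) * Real.exp (x * z)

/-- Kummer's confluent hypergeometric function
`₁F₁(a, b, z) = ∑ₖ (a)ₖ / (b)ₖ · zᵏ / k!`, with rising factorials `(a)ₖ`, `(b)ₖ`. -/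
def kummer (a b z : ℝ) : ℝ :=
  ∑' k : ℕ, (ascPochhammer ℝ k).eval a / (ascPochhammer ℝ k).eval b * z ^ k / (k ! : ℝ)

/-- The `k`-th term `Γ(β + k/2)⁻¹ He_k(z) (-r)ᵏ / k!` of the kernel series. Here
`Polynomial.hermite k` is the probabilists' Hermite polynomial
`He_k(z) = (-1)ᵏ φ⁽ᵏ⁾(z) / φ(z)`, `φ` the standard normal density. -/
def kernelTerm (β r z : ℝ) (k : ℕ) : ℝ :=
  (Real.Gamma (β + k / 2))⁻¹ * Polynomial.aeval z (Polynomial.hermite k) * (-r) ^ k / (k ! : ℝ)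

/-- The kernel `K_β(r, z) = ∑ₖ Γ(β + k/2)⁻¹ He_k(z) (-r)ᵏ / k!`, for real `z`. -/
def kernelK (β r z : ℝ) : ℝ :=
  ∑' k : ℕ, kernelTerm β r z k

/-- The sample mean `X̄ = (X_1 + ⋯ + X_n) / n`. -/
def sampleMean {n : ℕ} {Ω : Type*} (X : Fin n → Ω → ℝ) (ω : Ω) : ℝ :=
  (∑ i, X i ω) / n

/-- The quadratic form `Q = ∑ᵢ (X_i - X̄)²`. -/
def sampleQ {n : ℕ} {Ω : Type*} (X : Fin n → Ω → ℝ) (ω : Ω) : ℝ :=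
  ∑ i, (X i ω - sampleMean X ω) ^ 2

end

/-!
Why the formula holds. Write `A = ∑ α_i`, `β = A / 2 + 1`, `κ = √(n / 2)`, and let
`w(z) = ∏ M_{α_i}(√(2/n) z) φ(z)`, called `gammaWeight`.

The Laplace transform of the law of `Q` is computed by writing `Q = ∑ X_i² - (∑ X_i)² / n` and
linearising `exp(t (∑ X_i)² / n)` as a Gaussian integral. The coordinates then separate, each factor
is a value of `M_{α_i}` after scaling by `√t`, and a translation of the Gaussian variable gives
`E exp(-tQ) = t^(-A/2) ∫ w(z) exp(-az - a²/2) dz` with `a = κ / √t` (`lintegral_exp_neg_sumSqDev`).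
On the other side, the Hermite generating function and termwise integration show that
`x ^ (β - 1) K_β(κ √x, z)` has Laplace transform `t^(-β) exp(-az - a²/2)` in `x`
(`integral_exp_mul_kernelK`). Hence the distribution function of `Q` and the claimed integral have
the same Laplace transform, and uniqueness (`ae_eq_of_forall_integral_exp_mul_eq`), continuity of
the integral in `x` and right continuity of the distribution function finish the proof.

The delicate point is absolute convergence of the double integral. The weight `w` has no Gaussian
decay as `z → ∞`, where it behaves like `z ^ (A - n)`, so decay of the kernel is needed, and its
power series does not show it. The kernel is therefore represented by an inverse Laplace integral
over the line `Re s = 1` (`integral_verticalLine_eq_kernelK`), which bounds it by a superposition of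
exponentials `exp(-bz)` with `b = κ Re s^(-1/2) > 0`, weighted by `|s| ^ (-β)`. No asymptotics of
`M_α` are needed after that: the integral of `exp(-bz)` against `w` is, by the formula for
`E exp(-tQ)` read backwards, at most a constant times `|s| ^ (A/2) E exp(-tQ)` with
`t = (κ / b)² ≤ 2 |s|`. The bound `E exp(-tQ) ≤ 1` would leave the divergent integral of `|s| ^ (-1)`,
and any power gain `E exp(-tQ) = O(t ^ (-ε))` suffices. It comes from `Q ≥ (X_i - X_j)² / 2` and
Hölder's inequality, since a gamma density with shape `α` lies in `L ^ (1 + α)`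
(`exists_lintegral_exp_neg_sumSqDev_le`, `lintegral_kernelMajorant_mul_lt_top`).
-/

open Set Filter Topology
open scoped FourierTransform

/-! ### The functions `M_α` -/

lemma integrableOn_gammaM_integrand {α : ℝ} (hα : 0 < α) (z : ℝ) :
    IntegrableOn (fun x : ℝ => Real.exp (-x ^ 2) * x ^ (α - 1) * Real.exp (x * z)) (Ioi 0) := by
  have h := (integrableOn_rpow_mul_exp_neg_mul_sq (b := 1 / 2) (by norm_num)
    (s := α - 1) (by linarith)).mul_const (Real.exp (z ^ 2 / 2))
  refine Integrable.mono' h (by fun_prop) ?_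
  filter_upwards [ae_restrict_mem measurableSet_Ioi] with x hx
  have hx0 : 0 < x := hx
  rw [Real.norm_of_nonneg (by positivity)]
  have h1 : Real.exp (-x ^ 2) * Real.exp (x * z)
      ≤ Real.exp (-(1 / 2) * x ^ 2) * Real.exp (z ^ 2 / 2) := by
    rw [← Real.exp_add, ← Real.exp_add, Real.exp_le_exp]
    nlinarith [sq_nonneg (x - z)]
  calc Real.exp (-x ^ 2) * x ^ (α - 1) * Real.exp (x * z)
      = x ^ (α - 1) * (Real.exp (-x ^ 2) * Real.exp (x * z)) := by ring
    _ ≤ x ^ (α - 1) * (Real.exp (-(1 / 2) * x ^ 2) * Real.exp (z ^ 2 / 2)) := by gcongr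
    _ = _ := by ring

lemma gammaM_nonneg {α : ℝ} (hα : 0 < α) (z : ℝ) : 0 ≤ gammaM α z := by
  refine mul_nonneg (inv_nonneg.2 (Real.Gamma_pos_of_pos hα).le) ?_
  refine setIntegral_nonneg measurableSet_Ioi fun x hx => ?_
  have : 0 < x := hx
  positivity

lemma measurable_gammaM (α : ℝ) : Measurable (gammaM α) := by
  have h : StronglyMeasurable (fun p : ℝ × ℝ =>
      Real.exp (-p.2 ^ 2) * p.2 ^ (α - 1) * Real.exp (p.2 * p.1)) := by
    apply Measurable.stronglyMeasurable
    fun_prop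
  exact (h.integral_prod_right' (ν := volume.restrict (Ioi (0 : ℝ)))).measurable.const_mul _

lemma integral_exp_neg_sq_mul_rpow {s : ℝ} (hs : 0 < s) :
    ∫ x in Ioi (0 : ℝ), Real.exp (-x ^ 2) * x ^ (s - 1) = Real.Gamma (s / 2) / 2 := by
  have h := integral_rpow_mul_exp_neg_rpow (p := 2) (q := s - 1) two_pos (by linarith)
  rw [sub_add_cancel] at h
  rw [div_eq_inv_mul, ← one_div, ← h]
  refine setIntegral_congr_fun measurableSet_Ioi fun x hx => ?_
  simp only [Real.rpow_two]
  ring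

lemma hasSum_gammaM {α : ℝ} (hα : 0 < α) (z : ℝ) :
    HasSum (fun k : ℕ => (2 * Real.Gamma α)⁻¹ * (Real.Gamma ((α + k) / 2) * z ^ k / (k ! : ℝ)))
      (gammaM α z) := by
  have hexp : ∀ y : ℝ, HasSum (fun k : ℕ => y ^ k / (k ! : ℝ)) (Real.exp y) := fun y => by
    rw [Real.exp_eq_exp_ℝ]
    exact NormedSpace.expSeries_div_hasSum_exp y
  have key : HasSum (fun k : ℕ => ∫ x in Ioi (0 : ℝ),
      Real.exp (-x ^ 2) * x ^ (α - 1) * ((x * z) ^ k / (k ! : ℝ)))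
      (∫ x in Ioi (0 : ℝ), Real.exp (-x ^ 2) * x ^ (α - 1) * Real.exp (x * z)) := by
    refine hasSum_integral_of_dominated_convergence
      (fun k x => Real.exp (-x ^ 2) * x ^ (α - 1) * ((x * |z|) ^ k / (k ! : ℝ)))
      (fun k => by fun_prop) (fun k => ?_) (ae_of_all _ fun x => ?_) ?_
      (ae_of_all _ fun x => (hexp _).mul_left _)
    · filter_upwards [ae_restrict_mem measurableSet_Ioi] with x hx
      have hx0 : 0 < x := hx
      rw [norm_mul, Real.norm_of_nonneg (by positivity), norm_div, norm_pow, norm_mul,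
        Real.norm_of_nonneg hx0.le, Real.norm_eq_abs, Real.norm_natCast]
    · exact ((hexp _).mul_left _).summable
    · simp_rw [((hexp _).mul_left _).tsum_eq]
      exact integrableOn_gammaM_integrand hα _
  refine (key.mul_left (Real.Gamma α)⁻¹).congr_fun fun k => ?_
  have : ∫ x in Ioi (0 : ℝ), Real.exp (-x ^ 2) * x ^ (α - 1) * ((x * z) ^ k / (k ! : ℝ))
      = Real.Gamma ((α + k) / 2) / 2 * (z ^ k / (k ! : ℝ)) := by
    rw [← integral_exp_neg_sq_mul_rpow (by positivity), ← integral_mul_const]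
    refine setIntegral_congr_fun measurableSet_Ioi fun x hx => ?_
    have hx0 : 0 < x := hx
    have : x ^ (α + k - 1) = x ^ (α - 1) * x ^ k := by
      rw [← Real.rpow_natCast, ← Real.rpow_add hx0]; ring_nf
    simp only [this]
    ring
  rw [this]
  ring

lemma Gamma_add_nat_eq_ascPochhammer {s : ℝ} (hs : 0 < s) (k : ℕ) :
    Real.Gamma (s + k) = (ascPochhammer ℝ k).eval s * Real.Gamma s := by
  induction k with
  | zero => simp
  | succ k ih =>
    rw [Nat.cast_succ, ← add_assoc, Real.Gamma_add_one (by positivity), ih,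
      ascPochhammer_succ_eval]
    ring

lemma two_mul_factorial_eq_ascPochhammer (k : ℕ) :
    ((2 * k)! : ℝ) = 4 ^ k * (k ! : ℝ) * (ascPochhammer ℝ k).eval (1 / 2) := by
  induction k with
  | zero => simp
  | succ k ih =>
    rw [show 2 * (k + 1) = 2 * k + 1 + 1 by ring, Nat.factorial_succ, Nat.factorial_succ,
      Nat.factorial_succ, ascPochhammer_succ_eval]
    push_cast
    rw [ih]
    ring

lemma two_mul_add_one_factorial_eq_ascPochhammer (k : ℕ) :
    ((2 * k + 1)! : ℝ) = 4 ^ k * (k ! : ℝ) * (ascPochhammer ℝ k).eval (3 / 2) := by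
  induction k with
  | zero => simp
  | succ k ih =>
    rw [show 2 * (k + 1) + 1 = 2 * k + 1 + 1 + 1 by ring, Nat.factorial_succ,
      Nat.factorial_succ, Nat.factorial_succ k, ascPochhammer_succ_eval]
    push_cast
    rw [ih]
    ring

lemma gammaM_term_even {α : ℝ} (hα : 0 < α) (z : ℝ) (k : ℕ) :
    Real.Gamma ((α + (2 * k : ℕ)) / 2) * z ^ (2 * k) / ((2 * k)! : ℝ) =
      Real.Gamma (α / 2) * ((ascPochhammer ℝ k).eval (α / 2) / (ascPochhammer ℝ k).eval (1 / 2) *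
        (z ^ 2 / 4) ^ k / (k ! : ℝ)) := by
  rw [two_mul_factorial_eq_ascPochhammer, show (α + (2 * k : ℕ)) / 2 = α / 2 + k by
      push_cast; ring, Gamma_add_nat_eq_ascPochhammer (by positivity), div_pow, ← pow_mul]
  have := (ascPochhammer_pos k (1 / 2 : ℝ) (by norm_num)).ne'
  have hk : (k ! : ℝ) ≠ 0 := by positivity
  field_simp

lemma gammaM_term_odd {α : ℝ} (hα : 0 < α) (z : ℝ) (k : ℕ) :
    Real.Gamma ((α + (2 * k + 1 : ℕ)) / 2) * z ^ (2 * k + 1) / ((2 * k + 1)! : ℝ) =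
      Real.Gamma ((α + 1) / 2) * z * ((ascPochhammer ℝ k).eval ((α + 1) / 2) /
        (ascPochhammer ℝ k).eval (3 / 2) * (z ^ 2 / 4) ^ k / (k ! : ℝ)) := by
  rw [two_mul_add_one_factorial_eq_ascPochhammer,
    show (α + (2 * k + 1 : ℕ)) / 2 = (α + 1) / 2 + k by push_cast; ring,
    Gamma_add_nat_eq_ascPochhammer (by positivity), div_pow, pow_succ, ← pow_mul]
  have := (ascPochhammer_pos k (3 / 2 : ℝ) (by norm_num)).ne'
  have hk : (k ! : ℝ) ≠ 0 := by positivity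
  field_simp

lemma gammaM_eq_kummer {α : ℝ} (hα : 0 < α) (z : ℝ) :
    gammaM α z = (2 * Real.Gamma α)⁻¹ *
        (Real.Gamma (α / 2) * kummer (α / 2) (1 / 2) (z ^ 2 / 4) +
          Real.Gamma ((α + 1) / 2) * z * kummer ((α + 1) / 2) (3 / 2) (z ^ 2 / 4)) := by
  have h := hasSum_gammaM hα z
  have hc : (2 * Real.Gamma α)⁻¹ ≠ 0 :=
    inv_ne_zero (mul_ne_zero two_ne_zero (Real.Gamma_pos_of_pos hα).ne')
  have hs := (summable_mul_left_iff hc).1 h.summable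
  have h_even : Function.Injective fun k : ℕ => 2 * k := mul_right_injective₀ two_ne_zero
  have h_odd : Function.Injective fun k : ℕ => 2 * k + 1 := fun a b hab => by
    simpa using hab
  rw [← h.tsum_eq, tsum_mul_left,
    ← tsum_even_add_odd (f := fun i : ℕ => Real.Gamma ((α + i) / 2) * z ^ i / (i ! : ℝ))
      (hs.comp_injective h_even) (hs.comp_injective h_odd),
    kummer, kummer, ← tsum_mul_left, ← tsum_mul_left]
  rw [tsum_congr (gammaM_term_even hα z), tsum_congr (gammaM_term_odd hα z)]

/-! ### Hermite polynomials and the kernel series -/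

lemma iteratedDeriv_cexp_hermite (z : ℂ) (k : ℕ) :
    iteratedDeriv k (fun w : ℂ => Complex.exp (z * w - w ^ 2 / 2)) =
      fun w => Polynomial.aeval (z - w) (Polynomial.hermite k) *
        Complex.exp (z * w - w ^ 2 / 2) := by
  induction k with
  | zero => simp
  | succ k ih =>
    -- the step is the recursion `He_{k+1} = X He_k - He_k'`
    rw [iteratedDeriv_succ, ih]
    funext w
    have h1 : HasDerivAt (fun w : ℂ => Complex.exp (z * w - w ^ 2 / 2))
        (Complex.exp (z * w - w ^ 2 / 2) * (z - w)) w := by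
      have : HasDerivAt (fun w : ℂ => z * w - w ^ 2 / 2) (z - w) w := by
        convert! ((hasDerivAt_id' w).const_mul z).sub (((hasDerivAt_id' w).pow 2).div_const 2) using 1
        simp
      exact this.cexp
    have h2 : HasDerivAt (fun w : ℂ => Polynomial.aeval (z - w) (Polynomial.hermite k))
        (Polynomial.aeval (z - w) (Polynomial.derivative (Polynomial.hermite k)) * -1) w :=
      ((Polynomial.hermite k).hasDerivAt_aeval (z - w)).comp w ((hasDerivAt_id w).const_sub z)
    rw [(h2.fun_mul h1).deriv, Polynomial.hermite_succ]
    simp only [map_sub, map_mul, Polynomial.aeval_X]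
    ring

/-- Generating function of the Hermite polynomials. -/
lemma hasSum_hermite (z a : ℂ) :
    HasSum (fun k : ℕ => Polynomial.aeval z (Polynomial.hermite k) * a ^ k / (k ! : ℂ))
      (Complex.exp (z * a - a ^ 2 / 2)) := by
  have hd : Differentiable ℂ fun w : ℂ => Complex.exp (z * w - w ^ 2 / 2) := by fun_prop
  refine (Complex.hasSum_taylorSeries_of_entire hd 0 a).congr_fun fun k => ?_
  rw [iteratedDeriv_cexp_hermite]
  simp only [sub_zero, smul_eq_mul]
  simp
  ring

lemma ofReal_aeval_hermite (z : ℝ) (k : ℕ) :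
    ((Polynomial.aeval z (Polynomial.hermite k) : ℝ) : ℂ) =
      Polynomial.aeval (z : ℂ) (Polynomial.hermite k) := by
  simpa using (Polynomial.aeval_algebraMap_apply ℂ z (Polynomial.hermite k)).symm

lemma hasSum_hermite_real (z a : ℝ) :
    HasSum (fun k : ℕ => Polynomial.aeval z (Polynomial.hermite k) * a ^ k / (k ! : ℝ))
      (Real.exp (z * a - a ^ 2 / 2)) := by
  rw [← Complex.hasSum_ofReal]
  push_cast
  simp_rw [ofReal_aeval_hermite]
  exact hasSum_hermite z a

lemma summable_abs_hermite (z : ℝ) {a : ℝ} (ha : 0 ≤ a) :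
    Summable fun k : ℕ => |Polynomial.aeval z (Polynomial.hermite k)| * a ^ k / (k ! : ℝ) := by
  refine (hasSum_hermite_real z a).summable.abs.congr fun k => ?_
  rw [abs_div, abs_mul, abs_pow, abs_of_nonneg ha, Nat.abs_cast]

lemma abs_kernelTerm {β : ℝ} (hβ : 0 < β) {r : ℝ} (hr : 0 ≤ r) (z : ℝ) (k : ℕ) :
    |kernelTerm β r z k| = (Real.Gamma (β + k / 2))⁻¹ *
      (|Polynomial.aeval z (Polynomial.hermite k)| * r ^ k / (k ! : ℝ)) := by
  have hΓ : 0 < Real.Gamma (β + k / 2) := Real.Gamma_pos_of_pos (by positivity)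
  rw [kernelTerm, abs_div, abs_mul, abs_mul, abs_pow, abs_neg, abs_of_nonneg hr, Nat.abs_cast,
    abs_of_pos (inv_pos.2 hΓ)]
  ring

lemma one_le_Gamma {s : ℝ} (hs : 2 ≤ s) : 1 ≤ Real.Gamma s := by
  rw [← Real.Gamma_two]
  exact Real.Gamma_strictMonoOn_Ici.monotoneOn self_mem_Ici hs hs

/-- A bound uniform in `r ∈ [0, R]`. The first factor on the right is `1` for `k ≥ 4`, so that the
kernel series is dominated by the Hermite generating series at `R` up to finitely many terms. -/
lemma abs_kernelTerm_le {β : ℝ} (hβ : 0 < β) {r R : ℝ} (hr : 0 ≤ r) (hrR : r ≤ R) (z : ℝ) (k : ℕ) :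
    |kernelTerm β r z k| ≤ (max 1 (Real.Gamma (β + k / 2))⁻¹) *
      (|Polynomial.aeval z (Polynomial.hermite k)| * R ^ k / (k ! : ℝ)) := by
  rw [abs_kernelTerm hβ hr]
  have hΓ : 0 < Real.Gamma (β + k / 2) := Real.Gamma_pos_of_pos (by positivity)
  gcongr
  exact le_max_right _ _

lemma summable_max_inv_Gamma_mul_hermite (β z : ℝ) {R : ℝ} (hR : 0 ≤ R) (hβ : 0 < β) :
    Summable fun k : ℕ => (max 1 (Real.Gamma (β + k / 2))⁻¹) *
      (|Polynomial.aeval z (Polynomial.hermite k)| * R ^ k / (k ! : ℝ)) := by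
  refine Summable.of_norm_bounded_eventually_nat (summable_abs_hermite z hR) ?_
  filter_upwards [eventually_ge_atTop 4] with k hk
  have hk' : (4 : ℝ) ≤ k := by exact_mod_cast hk
  have h1 : (Real.Gamma (β + k / 2))⁻¹ ≤ 1 := inv_le_one_of_one_le₀ (one_le_Gamma (by linarith))
  rw [max_eq_left h1, one_mul, Real.norm_of_nonneg (by positivity)]

lemma summable_abs_kernelTerm {β : ℝ} (hβ : 0 < β) {r : ℝ} (hr : 0 ≤ r) (z : ℝ) :
    Summable fun k : ℕ => |kernelTerm β r z k| :=
  Summable.of_nonneg_of_le (fun _ => abs_nonneg _) (fun k => abs_kernelTerm_le hβ hr le_rfl z k)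
    (summable_max_inv_Gamma_mul_hermite β z hr hβ)

lemma hasSum_kernelK {β : ℝ} (hβ : 0 < β) {r : ℝ} (hr : 0 ≤ r) (z : ℝ) :
    HasSum (kernelTerm β r z) (kernelK β r z) :=
  (summable_abs_kernelTerm hβ hr z).of_abs.hasSum

lemma continuousOn_kernelK {β : ℝ} (hβ : 0 < β) (z : ℝ) :
    ContinuousOn (fun r => kernelK β r z) (Ici 0) := by
  have key : ∀ R : ℝ, 0 ≤ R → ContinuousOn (fun r => kernelK β r z) (Icc 0 R) := fun R hR =>
    continuousOn_tsum (fun k => by unfold kernelTerm; fun_prop)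
      (summable_max_inv_Gamma_mul_hermite β z hR hβ)
      (fun k r hr => abs_kernelTerm_le hβ hr.1 hr.2 z k)
  intro r hr
  refine ((key (r + 1) (add_nonneg hr zero_le_one)) r ⟨hr, by linarith⟩).mono_of_mem_nhdsWithin ?_
  filter_upwards [self_mem_nhdsWithin, mem_nhdsWithin_of_mem_nhds (Iic_mem_nhds (lt_add_one r))]
    with y h1 h2 using ⟨h1, h2⟩

lemma measurable_kernelK_comp {β : ℝ} (hβ : 0 < β) {X : Type*} [MeasurableSpace X] {f g : X → ℝ}
    (hf : Measurable f) (hf0 : ∀ x, 0 ≤ f x) (hg : Measurable g) :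
    Measurable fun x => kernelK β (f x) (g x) := by
  refine measurable_of_tendsto_metrizable
    (f := fun N x => ∑ k ∈ Finset.range N, kernelTerm β (f x) (g x) k) (fun N => ?_)
    (tendsto_pi_nhds.2 fun x => (hasSum_kernelK hβ (hf0 x) (g x)).tendsto_sum_nat)
  refine Finset.measurable_fun_sum _ fun k _ => ?_
  have : Measurable fun z : ℝ => Polynomial.aeval z (Polynomial.hermite k) :=
    (Polynomial.continuous_aeval _).measurable
  unfold kernelTerm
  exact (((this.comp hg).const_mul _).mul (hf.neg.pow_const k)).div_const _

/-! ### Inversion of the Laplace transform of powers along `Re s = 1` -/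

/-- Identity theorem: analytic functions on the half-plane `Re z < c` that agree at its real points
are equal. -/
lemma eqOn_halfPlane_of_eq_ofReal {f g : ℂ → ℂ} {c : ℝ}
    (hf : AnalyticOnNhd ℂ f {z | z.re < c}) (hg : AnalyticOnNhd ℂ g {z | z.re < c})
    (h : ∀ x : ℝ, x < c → f x = g x) : EqOn f g {z | z.re < c} := by
  refine hf.eqOn_of_preconnected_of_frequently_eq hg
    (convex_halfSpace_re_lt c).isPreconnected (z₀ := ((c - 1 : ℝ) : ℂ)) (by simp) ?_
  -- the real points `x < c - 1` accumulate at `c - 1`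
  have h1 : Tendsto (fun x : ℝ => (x : ℂ)) (𝓝[<] (c - 1)) (𝓝[≠] ((c - 1 : ℝ) : ℂ)) := by
    refine tendsto_nhdsWithin_iff.2 ⟨(Complex.continuous_ofReal.tendsto _).mono_left
      nhdsWithin_le_nhds, ?_⟩
    filter_upwards [self_mem_nhdsWithin] with x hx
    simpa [← Complex.ofReal_one, ← Complex.ofReal_sub] using (ne_of_lt hx)
  refine h1.frequently (Eventually.frequently ?_)
  filter_upwards [self_mem_nhdsWithin] with x hx
  have : x < c - 1 := hx
  exact h x (by linarith)

lemma toReal_gammaPDF {α : ℝ} (hα : 0 < α) (x : ℝ) :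
    (gammaPDF α 1 x).toReal = gammaPDFReal α 1 x :=
  ENNReal.toReal_ofReal (gammaPDFReal_nonneg hα one_pos x)

lemma integrable_gammaPDFReal {α : ℝ} (hα : 0 < α) : Integrable (gammaPDFReal α 1) := by
  refine (integrable_toReal_of_lintegral_ne_top (f := gammaPDF α 1)
    (by unfold gammaPDF; fun_prop) ?_).congr (ae_of_all _ (toReal_gammaPDF hα))
  simp [lintegral_gammaPDF_eq_one hα one_pos]

lemma integral_gammaMeasure {E : Type*} [NormedAddCommGroup E] [NormedSpace ℝ E] {α : ℝ}
    (hα : 0 < α) (f : ℝ → E) :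
    ∫ x, f x ∂gammaMeasure α 1 =
      ∫ x in Ioi (0 : ℝ), ((Real.Gamma α)⁻¹ * x ^ (α - 1) * Real.exp (-x)) • f x := by
  rw [gammaMeasure, integral_withDensity_eq_integral_toReal_smul
    (f := gammaPDF α 1) (by unfold gammaPDF; fun_prop) (by simp [gammaPDF]),
    ← integral_Ici_eq_integral_Ioi, ← integral_indicator measurableSet_Ici]
  refine integral_congr_ae (ae_of_all _ fun x => ?_)
  simp only [toReal_gammaPDF hα, gammaPDFReal, Set.indicator_apply, mem_Ici]
  split_ifs <;> simp

lemma mgf_gammaMeasure {α : ℝ} (hα : 0 < α) {t : ℝ} (ht : t < 1) :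
    mgf id (gammaMeasure α 1) t = (1 - t) ^ (-α) := by
  rw [mgf, integral_gammaMeasure hα]
  have h := Real.integral_rpow_mul_exp_neg_mul_Ioi hα (sub_pos.2 ht)
  have hΓ := (Real.Gamma_pos_of_pos hα).ne'
  have h2 : (1 - t) ^ (-α) = (1 / (1 - t)) ^ α := by
    rw [Real.rpow_neg (by linarith), ← Real.inv_rpow (by linarith), one_div]
  rw [h2, ← mul_div_cancel_right₀ ((1 / (1 - t)) ^ α) hΓ, ← h, div_eq_inv_mul,
    ← integral_const_mul]
  refine setIntegral_congr_fun measurableSet_Ioi fun x _ => ?_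
  simp only [smul_eq_mul, id]
  rw [show -((1 - t) * x) = -x + t * x by ring, Real.exp_add]
  ring

lemma Iio_one_subset_integrableExpSet_gammaMeasure {α : ℝ} (hα : 0 < α) :
    Iio 1 ⊆ integrableExpSet id (gammaMeasure α 1) := by
  intro t ht
  have := isProbabilityMeasure_gammaMeasure hα one_pos
  rw [integrableExpSet, mem_ofPred_eq, ← mgf_pos_iff, mgf_gammaMeasure hα ht]
  exact Real.rpow_pos_of_pos (sub_pos.2 ht) _

lemma complexMGF_gammaMeasure {α : ℝ} (hα : 0 < α) {z : ℂ} (hz : z.re < 1) :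
    complexMGF id (gammaMeasure α 1) z = (1 - z) ^ (-α : ℂ) := by
  have hsub : {z : ℂ | z.re < 1} ⊆
      {z : ℂ | z.re ∈ interior (integrableExpSet id (gammaMeasure α 1))} := fun z hz =>
    interior_mono (Iio_one_subset_integrableExpSet_gammaMeasure hα)
      (by rw [interior_Iio]; exact hz)
  refine eqOn_halfPlane_of_eq_ofReal (f := complexMGF id (gammaMeasure α 1))
    (g := fun z => (1 - z) ^ (-α : ℂ)) (analyticOnNhd_complexMGF.mono hsub) ?_ ?_ hz
  · refine DifferentiableOn.analyticOnNhd (fun z hz => ?_)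
      (isOpen_lt Complex.continuous_re continuous_const)
    refine DifferentiableAt.differentiableWithinAt ?_
    refine DifferentiableAt.cpow_const (by fun_prop) (Or.inl ?_)
    simpa using hz
  · intro x hx
    rw [complexMGF_ofReal, mgf_gammaMeasure hα hx, Complex.ofReal_cpow (by linarith)]
    push_cast
    rfl

/-- The point `1 + 2πiξ` of the vertical line `Re s = 1`, parametrised by the frequency `ξ` of the
Fourier transform `∫ exp(-2πiξx) f(x) dx`. -/
noncomputable def verticalLine (ξ : ℝ) : ℂ := 1 + (2 * Real.pi * ξ : ℝ) * Complex.I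

lemma verticalLine_re (ξ : ℝ) : (verticalLine ξ).re = 1 := by simp [verticalLine]

lemma continuous_verticalLine : Continuous verticalLine := by unfold verticalLine; fun_prop

lemma verticalLine_mem_slitPlane (ξ : ℝ) : verticalLine ξ ∈ Complex.slitPlane :=
  Or.inl (by simp [verticalLine_re])

lemma verticalLine_ne_zero (ξ : ℝ) : verticalLine ξ ≠ 0 :=
  Complex.slitPlane_ne_zero (verticalLine_mem_slitPlane ξ)

lemma one_le_norm_verticalLine (ξ : ℝ) : 1 ≤ ‖verticalLine ξ‖ := by
  have := Complex.abs_re_le_norm (verticalLine ξ)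
  rwa [verticalLine_re, abs_one] at this

lemma continuous_verticalLine_cpow (c : ℂ) : Continuous fun ξ => verticalLine ξ ^ c :=
  continuous_verticalLine.cpow continuous_const verticalLine_mem_slitPlane

lemma continuous_norm_verticalLine_rpow (c : ℝ) : Continuous fun ξ => ‖verticalLine ξ‖ ^ c :=
  continuous_verticalLine.norm.rpow_const fun ξ =>
    Or.inl (norm_ne_zero_iff.2 (verticalLine_ne_zero ξ))

lemma integrable_norm_verticalLine_rpow {γ : ℝ} (hγ : 1 < γ) :
    Integrable fun ξ => ‖verticalLine ξ‖ ^ (-γ) := by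
  have h := integrable_rpow_neg_one_add_norm_sq (E := ℝ) (μ := volume) (r := γ) (by simpa using hγ)
  refine h.mono' (continuous_norm_verticalLine_rpow _).aestronglyMeasurable
    (ae_of_all _ fun ξ => ?_)
  rw [Real.norm_of_nonneg (by positivity)]
  have h1 : ((1 : ℝ) + ‖ξ‖ ^ 2) ≤ ‖verticalLine ξ‖ ^ 2 := by
    rw [← Complex.normSq_eq_norm_sq, Complex.normSq_apply]
    simp only [verticalLine, Complex.add_re, Complex.one_re, Complex.mul_re, Complex.ofReal_re,
      Complex.I_re, Complex.ofReal_im, Complex.I_im, Complex.add_im, Complex.one_im,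
      Complex.mul_im, Real.norm_eq_abs, sq_abs]
    have : 1 ≤ 2 * Real.pi := by linarith [Real.pi_gt_three]
    nlinarith [sq_nonneg ξ, mul_self_nonneg ξ, mul_le_mul this this zero_le_one (by linarith)]
  calc ‖verticalLine ξ‖ ^ (-γ) = (‖verticalLine ξ‖ ^ 2) ^ (-γ / 2) := by
        rw [← Real.rpow_natCast, ← Real.rpow_mul (norm_nonneg _)]
        congr 1
        push_cast
        ring
    _ ≤ _ := Real.rpow_le_rpow_of_nonpos (by positivity) h1 (by linarith)

lemma norm_verticalLine_cpow (ξ c : ℝ) :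
    ‖verticalLine ξ ^ (c : ℂ)‖ = ‖verticalLine ξ‖ ^ c := Complex.norm_cpow_real _ _

/-- Inversion formula for the Laplace transform `Γ(γ) s^(-γ)` of `x^(γ-1)`, along `Re s = 1`. -/
lemma integral_cexp_mul_verticalLine_cpow {γ : ℝ} (hγ : 1 < γ) {x : ℝ} (hx : 0 < x) :
    ∫ ξ, Complex.exp (x * verticalLine ξ) * verticalLine ξ ^ (-γ : ℂ) =
      ((x ^ (γ - 1) / Real.Gamma γ : ℝ) : ℂ) := by
  have hγ0 : 0 < γ := by linarith
  let f : ℝ → ℂ := fun x => (gammaPDFReal γ 1 x : ℂ)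
  have hfour : 𝓕 f = fun ξ => verticalLine ξ ^ (-γ : ℂ) := by
    funext ξ
    have h1 : (1 : ℂ) - (-(2 * Real.pi * ξ : ℝ) * Complex.I) = verticalLine ξ := by
      simp [verticalLine]
    rw [← h1, ← complexMGF_gammaMeasure hγ0 (by simp), Real.fourier_eq', complexMGF, gammaMeasure,
      integral_withDensity_eq_integral_toReal_smul
      (f := gammaPDF γ 1) (by unfold gammaPDF; fun_prop) (by simp [gammaPDF])]
    refine integral_congr_ae (ae_of_all _ fun y => ?_)
    simp only [toReal_gammaPDF hγ0, f, Complex.real_smul, smul_eq_mul, id, RCLike.inner_apply, conj_trivial]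
    rw [mul_comm]
    congr 2
    push_cast
    ring
  have hf : Integrable f := (integrable_gammaPDFReal hγ0).ofReal
  have hF : Integrable (𝓕 f) := by
    rw [hfour]
    refine (integrable_norm_verticalLine_rpow hγ).mono'
      (continuous_verticalLine_cpow _).aestronglyMeasurable (ae_of_all _ fun ξ => ?_)
    rw [← norm_verticalLine_cpow]
    simp
  have hpdf : ∀ y : ℝ, 0 < y →
      gammaPDFReal γ 1 y = y ^ (γ - 1) / Real.Gamma γ * Real.exp (-y) := fun y hy => by
    rw [gammaPDFReal, if_pos hy.le, Real.one_rpow, one_mul]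
    ring
  have hcont : ContinuousAt f x := by
    have : ContinuousAt (fun y : ℝ => ((y ^ (γ - 1) / Real.Gamma γ * Real.exp (-y) : ℝ) : ℂ)) x := by
      refine Complex.continuous_ofReal.continuousAt.comp ?_
      exact ((Real.continuousAt_rpow_const x _ (Or.inl hx.ne')).div_const _).mul (by fun_prop)
    refine this.congr ?_
    filter_upwards [Ioi_mem_nhds hx] with y hy
    simp only [f, hpdf y hy]
  have hinv := hf.fourierInv_fourier_eq hF hcont
  rw [hfour, Real.fourierInv_eq'] at hinv
  have h2 : ((x ^ (γ - 1) / Real.Gamma γ : ℝ) : ℂ) = Complex.exp x * f x := by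
    simp only [f, hpdf x hx]
    push_cast
    rw [mul_comm, mul_assoc, ← Complex.exp_add]
    simp
  rw [h2, ← hinv, ← integral_const_mul]
  refine integral_congr_ae (ae_of_all _ fun ξ => ?_)
  simp only [verticalLine, smul_eq_mul, RCLike.inner_apply, conj_trivial]
  rw [← mul_assoc, ← Complex.exp_add]
  congr 2
  push_cast
  ring

/-! ### Laplace transform and inverse Laplace representation of the kernel -/

lemma rpow_mul_kernelTerm {β κ x : ℝ} (hx : 0 < x) (z : ℝ) (k : ℕ) :
    x ^ (β - 1) * kernelTerm β (κ * Real.sqrt x) z k =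
      Polynomial.aeval z (Polynomial.hermite k) * (-κ) ^ k / (k ! : ℝ) *
        (x ^ (β + k / 2 - 1) / Real.Gamma (β + k / 2)) := by
  have h1 : x ^ (β + k / 2 - 1) = x ^ (β - 1) * Real.sqrt x ^ k := by
    rw [Real.sqrt_eq_rpow, ← Real.rpow_natCast, ← Real.rpow_mul hx.le, ← Real.rpow_add hx]
    congr 1
    ring
  rw [kernelTerm, h1, neg_mul_eq_neg_mul, mul_pow]
  ring

/-- Termwise Laplace transform of the kernel; the result is `t ^ (-β) φ(z + a) / φ(z)` with
`a = κ / √t`. -/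
lemma integral_exp_mul_kernelK {β κ t : ℝ} (hβ : 0 < β) (hκ : 0 ≤ κ) (ht : 0 < t) (z : ℝ) :
    ∫ x in Ioi (0 : ℝ), Real.exp (-(t * x)) * (x ^ (β - 1) * kernelK β (κ * Real.sqrt x) z) =
      t ^ (-β) * Real.exp (-(z * (κ / Real.sqrt t)) - (κ / Real.sqrt t) ^ 2 / 2) := by
  set F : ℕ → ℝ → ℝ := fun k x =>
    Real.exp (-(t * x)) * (x ^ (β - 1) * kernelTerm β (κ * Real.sqrt x) z k) with hF
  have hFeq : ∀ k, ∀ x ∈ Ioi (0 : ℝ), F k x =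
      Polynomial.aeval z (Polynomial.hermite k) * (-κ) ^ k / (k ! : ℝ) /
        Real.Gamma (β + k / 2) * (x ^ (β + k / 2 - 1) * Real.exp (-(t * x))) := by
    intro k x hx
    simp only [hF, rpow_mul_kernelTerm hx]
    ring
  have hpos : ∀ k : ℕ, 0 < β + k / 2 := fun k => by positivity
  have hsqrt : ∀ k : ℕ, (1 / t) ^ (β + k / 2) = t ^ (-β) * (Real.sqrt t)⁻¹ ^ k := by
    intro k
    rw [Real.sqrt_eq_rpow, one_div, Real.inv_rpow ht.le, ← Real.rpow_neg ht.le,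
      ← Real.rpow_neg ht.le, ← Real.rpow_natCast, ← Real.rpow_mul ht.le, ← Real.rpow_add ht]
    congr 1
    ring
  have hint : ∀ k, Integrable (F k) (volume.restrict (Ioi 0)) := fun k => by
    have h := (integrableOn_rpow_mul_exp_neg_mul_rpow (p := 1) (s := β + k / 2 - 1) (b := t)
      (by linarith [hpos k]) one_pos ht)
    refine IntegrableOn.congr_fun (Integrable.const_mul h
      (Polynomial.aeval z (Polynomial.hermite k) * (-κ) ^ k / (k ! : ℝ) /
        Real.Gamma (β + k / 2))) (fun x hx => ?_) measurableSet_Ioi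
    rw [hFeq k x hx]
    simp only [Real.rpow_one, neg_mul]
  have hnorm : ∀ k, ∫ x in Ioi (0 : ℝ), ‖F k x‖ = t ^ (-β) *
      (|Polynomial.aeval z (Polynomial.hermite k)| * (κ / Real.sqrt t) ^ k / (k ! : ℝ)) := by
    intro k
    have h1 : ∀ x ∈ Ioi (0 : ℝ), ‖F k x‖ = |Polynomial.aeval z (Polynomial.hermite k)| * κ ^ k /
        (k ! : ℝ) / Real.Gamma (β + k / 2) * (x ^ (β + k / 2 - 1) * Real.exp (-(t * x))) := by
      intro x hx
      have hx0 : 0 < x := hx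
      rw [hFeq k x hx, norm_mul, norm_div, norm_div, norm_mul, norm_pow, norm_neg,
        Real.norm_of_nonneg hκ, Real.norm_natCast,
        Real.norm_of_nonneg (Real.Gamma_pos_of_pos (hpos k)).le,
        Real.norm_of_nonneg (by positivity : 0 ≤ x ^ (β + k / 2 - 1) * Real.exp (-(t * x))),
        Real.norm_eq_abs]
    rw [setIntegral_congr_fun measurableSet_Ioi h1, integral_const_mul,
      Real.integral_rpow_mul_exp_neg_mul_Ioi (hpos k) ht, hsqrt,
      div_eq_mul_inv κ, mul_pow]
    have := (Real.Gamma_pos_of_pos (hpos k)).ne'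
    field_simp
  have hval : ∀ k, ∫ x in Ioi (0 : ℝ), F k x = t ^ (-β) *
      (Polynomial.aeval z (Polynomial.hermite k) * (-(κ / Real.sqrt t)) ^ k / (k ! : ℝ)) := by
    intro k
    rw [setIntegral_congr_fun measurableSet_Ioi (hFeq k), integral_const_mul,
      Real.integral_rpow_mul_exp_neg_mul_Ioi (hpos k) ht, hsqrt,
      div_eq_mul_inv κ, neg_mul_eq_neg_mul, mul_pow (-κ)]
    have := (Real.Gamma_pos_of_pos (hpos k)).ne'
    field_simp
  have hsum := hasSum_integral_of_summable_integral_norm hint (by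
    simp_rw [hnorm]
    exact (summable_abs_hermite z (by positivity)).mul_left _)
  simp_rw [hval] at hsum
  have h2 := hsum.unique ((hasSum_hermite_real z (-(κ / Real.sqrt t))).mul_left _)
  rw [neg_sq, mul_neg] at h2
  rw [← h2]
  refine setIntegral_congr_fun measurableSet_Ioi fun x _ => ?_
  simp only [hF]
  rw [tsum_mul_left, tsum_mul_left]
  rfl

lemma verticalLine_cpow_neg_half_sq (ξ : ℝ) :
    (verticalLine ξ ^ (-(1 / 2) : ℂ)) ^ 2 = (verticalLine ξ)⁻¹ := by
  rw [← Complex.cpow_nat_mul, ← Complex.cpow_neg_one]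
  norm_num

lemma verticalLine_cpow_add_half_nat (β ξ : ℝ) (k : ℕ) :
    verticalLine ξ ^ (-(β + k / 2 : ℝ) : ℂ) =
      verticalLine ξ ^ (-β : ℂ) * (verticalLine ξ ^ (-(1 / 2) : ℂ)) ^ k := by
  rw [← Complex.cpow_nat_mul, ← Complex.cpow_add _ _ (verticalLine_ne_zero ξ)]
  congr 1
  push_cast
  ring

lemma norm_verticalLine_cpow_neg_half (ξ : ℝ) :
    ‖verticalLine ξ ^ (-(1 / 2) : ℂ)‖ = ‖verticalLine ξ‖ ^ (-(1 / 2) : ℝ) := by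
  rw [← norm_verticalLine_cpow]
  norm_num

lemma norm_verticalLine_cpow_neg_half_le (ξ : ℝ) :
    ‖verticalLine ξ ^ (-(1 / 2) : ℂ)‖ ≤ 1 := by
  rw [norm_verticalLine_cpow_neg_half]
  exact Real.rpow_le_one_of_one_le_of_nonpos (one_le_norm_verticalLine ξ) (by norm_num)

lemma re_inv_verticalLine_pos (ξ : ℝ) : 0 < ((verticalLine ξ)⁻¹).re := by
  rw [Complex.inv_re, verticalLine_re]
  exact div_pos one_pos (Complex.normSq_pos.2 (verticalLine_ne_zero ξ))

lemma re_verticalLine_cpow_neg_half_nonneg (ξ : ℝ) :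
    0 ≤ (verticalLine ξ ^ (-(1 / 2) : ℂ)).re := by
  rw [Complex.cpow_def_of_ne_zero (verticalLine_ne_zero ξ), Complex.exp_re]
  refine mul_nonneg (Real.exp_pos _).le (Real.cos_nonneg_of_mem_Icc ?_)
  have him : (Complex.log (verticalLine ξ) * (-(1 / 2) : ℂ)).im
      = -(1 / 2) * Complex.arg (verticalLine ξ) := by
    rw [show (-(1 / 2) : ℂ) = ((-(1 / 2) : ℝ) : ℂ) by push_cast; rfl, mul_comm,
      Complex.im_ofReal_mul, Complex.log_im]
  rw [him]
  have h1 := Complex.neg_pi_lt_arg (verticalLine ξ)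
  have h2 := Complex.arg_le_pi (verticalLine ξ)
  constructor <;> linarith

/-- The principal square root of `1 / s` lies in the sector `|arg| ≤ π / 4`, so that its real part
is comparable to its modulus. -/
lemma norm_sq_le_two_mul_re_sq (ξ : ℝ) :
    ‖verticalLine ξ‖ ^ (-1 : ℝ) ≤ 2 * (verticalLine ξ ^ (-(1 / 2) : ℂ)).re ^ 2 := by
  have h1 := re_inv_verticalLine_pos ξ
  rw [← verticalLine_cpow_neg_half_sq, sq, Complex.mul_re] at h1
  have h2 : ‖verticalLine ξ‖ ^ (-1 : ℝ) = ‖verticalLine ξ ^ (-(1 / 2) : ℂ)‖ ^ 2 := by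
    rw [norm_verticalLine_cpow_neg_half, ← Real.rpow_natCast, ← Real.rpow_mul (norm_nonneg _)]
    norm_num
  rw [h2, ← Complex.normSq_eq_norm_sq, Complex.normSq_apply]
  nlinarith

lemma re_verticalLine_cpow_neg_half_pos (ξ : ℝ) :
    0 < (verticalLine ξ ^ (-(1 / 2) : ℂ)).re := by
  refine lt_of_le_of_ne (re_verticalLine_cpow_neg_half_nonneg ξ) fun h => ?_
  have h1 := norm_sq_le_two_mul_re_sq ξ
  rw [← h] at h1
  have := Real.rpow_pos_of_pos (one_pos.trans_le (one_le_norm_verticalLine ξ)) (-1)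
  linarith

lemma re_verticalLine_cpow_neg_half_le (ξ : ℝ) :
    (verticalLine ξ ^ (-(1 / 2) : ℂ)).re ≤ 1 :=
  (Complex.re_le_norm _).trans (norm_verticalLine_cpow_neg_half_le ξ)

/-- The kernel as an inverse Laplace transform along `Re s = 1`. -/
lemma integral_verticalLine_eq_kernelK {β κ x : ℝ} (hβ : 1 < β) (hκ : 0 ≤ κ) (hx : 0 < x) (z : ℝ) :
    ∫ ξ, Complex.exp (x * verticalLine ξ) * verticalLine ξ ^ (-β : ℂ) *
      Complex.exp (z * (-κ * verticalLine ξ ^ (-(1 / 2) : ℂ)) -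
        (-κ * verticalLine ξ ^ (-(1 / 2) : ℂ)) ^ 2 / 2) =
      ((x ^ (β - 1) * kernelK β (κ * Real.sqrt x) z : ℝ) : ℂ) := by
  have hsum := hasSum_integral_of_dominated_convergence (μ := volume)
    (F := fun (k : ℕ) (ξ : ℝ) => Complex.exp (x * verticalLine ξ) * verticalLine ξ ^ (-β : ℂ) *
      (Polynomial.aeval (z : ℂ) (Polynomial.hermite k) *
        (-κ * verticalLine ξ ^ (-(1 / 2) : ℂ)) ^ k / (k ! : ℂ)))
    (f := fun ξ => Complex.exp (x * verticalLine ξ) * verticalLine ξ ^ (-β : ℂ) *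
      Complex.exp (z * (-κ * verticalLine ξ ^ (-(1 / 2) : ℂ)) -
        (-κ * verticalLine ξ ^ (-(1 / 2) : ℂ)) ^ 2 / 2))
    (fun k ξ => Real.exp x * ‖verticalLine ξ‖ ^ (-β) *
      (|Polynomial.aeval z (Polynomial.hermite k)| * κ ^ k / (k ! : ℝ)))
    (fun k => ?_) (fun k => ae_of_all _ fun ξ => ?_) (ae_of_all _ fun ξ => ?_) ?_
    (ae_of_all _ fun ξ => (hasSum_hermite _ _).mul_left _)
  · have hterm : ∀ k : ℕ, ∫ ξ, Complex.exp (x * verticalLine ξ) * verticalLine ξ ^ (-β : ℂ) *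
        (Polynomial.aeval (z : ℂ) (Polynomial.hermite k) *
          (-κ * verticalLine ξ ^ (-(1 / 2) : ℂ)) ^ k / (k ! : ℂ)) =
        ((x ^ (β - 1) * kernelTerm β (κ * Real.sqrt x) z k : ℝ) : ℂ) := by
      intro k
      have hγ : 1 < β + (k : ℝ) / 2 := by
        have : (0 : ℝ) ≤ k / 2 := by positivity
        linarith
      rw [rpow_mul_kernelTerm hx, Complex.ofReal_mul,
        ← integral_cexp_mul_verticalLine_cpow hγ hx, ← integral_const_mul]
      refine integral_congr_ae (ae_of_all _ fun ξ => ?_)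
      simp only [verticalLine_cpow_add_half_nat, mul_pow]
      push_cast
      rw [ofReal_aeval_hermite]
      ring
    simp_rw [hterm] at hsum
    refine hsum.unique ?_
    rw [Complex.hasSum_ofReal]
    exact (hasSum_kernelK (by linarith) (by positivity) z).mul_left _
  · refine Continuous.aestronglyMeasurable ?_
    have h1 := continuous_verticalLine
    have h2 := continuous_verticalLine_cpow (-β)
    have h3 := continuous_verticalLine_cpow (-(1 / 2))
    fun_prop
  · rw [norm_mul, norm_mul, Complex.norm_exp, Complex.re_ofReal_mul, verticalLine_re, mul_one,
      ← Complex.ofReal_neg, norm_verticalLine_cpow, norm_div, norm_mul, norm_pow, norm_mul,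
      ← ofReal_aeval_hermite, Complex.norm_real, norm_neg, Complex.norm_real, Complex.norm_natCast,
      Real.norm_of_nonneg hκ, Real.norm_eq_abs]
    gcongr
    exact mul_le_of_le_one_right hκ (norm_verticalLine_cpow_neg_half_le ξ)
  · exact (summable_abs_hermite z hκ).mul_left _
  · simp_rw [tsum_mul_left]
    exact ((integrable_norm_verticalLine_rpow hβ).const_mul _).mul_const _

/-- Uniform bound for the kernel by a superposition of decaying exponentials in `z`. -/
lemma ofReal_abs_kernelK_le {β κ x : ℝ} (hβ : 1 < β) (hκ : 0 ≤ κ) (hx : 0 < x) (z : ℝ) :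
    ENNReal.ofReal |x ^ (β - 1) * kernelK β (κ * Real.sqrt x) z| ≤
      ENNReal.ofReal (Real.exp x) * ∫⁻ ξ, ENNReal.ofReal (‖verticalLine ξ‖ ^ (-β) *
        Real.exp (-(κ * (verticalLine ξ ^ (-(1 / 2) : ℂ)).re * z))) := by
  have h0 : ENNReal.ofReal |x ^ (β - 1) * kernelK β (κ * Real.sqrt x) z| =
      ‖((x ^ (β - 1) * kernelK β (κ * Real.sqrt x) z : ℝ) : ℂ)‖ₑ := by
    rw [← ofReal_norm, Complex.norm_real, Real.norm_eq_abs]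
  rw [h0, ← integral_verticalLine_eq_kernelK hβ hκ hx, ← lintegral_const_mul']
  swap
  · exact ENNReal.ofReal_ne_top
  refine (enorm_integral_le_lintegral_enorm _).trans (lintegral_mono fun ξ => ?_)
  rw [← ofReal_norm, ← ENNReal.ofReal_mul (Real.exp_pos _).le]
  refine ENNReal.ofReal_le_ofReal ?_
  rw [norm_mul, norm_mul, Complex.norm_exp, Complex.norm_exp, Complex.re_ofReal_mul,
    verticalLine_re, mul_one, ← Complex.ofReal_neg, norm_verticalLine_cpow, mul_assoc]
  gcongr
  have h1 : (-(κ : ℂ) * verticalLine ξ ^ (-(1 / 2) : ℂ)) ^ 2 / 2 =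
      ((κ ^ 2 / 2 : ℝ) : ℂ) * (verticalLine ξ)⁻¹ := by
    rw [mul_pow, verticalLine_cpow_neg_half_sq]
    push_cast
    ring
  have h2 := mul_nonneg (by positivity : 0 ≤ κ ^ 2 / 2) (re_inv_verticalLine_pos ξ).le
  rw [← Complex.ofReal_neg] at h1
  simp only [Complex.sub_re, ← Complex.ofReal_neg]
  rw [h1, Complex.re_ofReal_mul, Complex.re_ofReal_mul, Complex.re_ofReal_mul]
  nlinarith

/-! ### Laplace transform of the quadratic form under gamma laws -/

lemma lintegral_gammaMeasure {α : ℝ} {f : ℝ → ENNReal} (hf : Measurable f) :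
    ∫⁻ x, f x ∂gammaMeasure α 1 =
      ∫⁻ x in Ioi (0 : ℝ), ENNReal.ofReal ((Real.Gamma α)⁻¹ * x ^ (α - 1) * Real.exp (-x)) * f x := by
  rw [gammaMeasure, lintegral_withDensity_eq_lintegral_mul _ (by unfold gammaPDF; fun_prop) hf,
    ← setLIntegral_congr Ioi_ae_eq_Ici.symm, ← lintegral_indicator measurableSet_Ici]
  refine lintegral_congr fun x => ?_
  simp only [Pi.mul_apply, gammaPDF, gammaPDFReal, Set.indicator_apply, mem_Ici]
  split_ifs <;> simp

/-- The exponentially tilted Gaussian moments of a gamma variable are values of `gammaM`, by the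
scaling `x ↦ √t x`. -/
lemma lintegral_gammaMeasure_exp {α t : ℝ} (hα : 0 < α) (ht : 0 < t) (u : ℝ) :
    ∫⁻ x, ENNReal.ofReal (Real.exp (-(t * x ^ 2) + u * x)) ∂gammaMeasure α 1 =
      ENNReal.ofReal (t ^ (-(α / 2)) * gammaM α ((u - 1) / Real.sqrt t)) := by
  have hs : 0 < Real.sqrt t := Real.sqrt_pos.2 ht
  have hΓ := Real.Gamma_pos_of_pos hα
  set v := (u - 1) / Real.sqrt t with hv
  set g : ℝ → ℝ := fun y => Real.exp (-y ^ 2) * y ^ (α - 1) * Real.exp (y * v) with hg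
  have hgx : ∀ x ∈ Ioi (0 : ℝ),
      (Real.Gamma α)⁻¹ * x ^ (α - 1) * Real.exp (-x) * Real.exp (-(t * x ^ 2) + u * x) =
        (Real.Gamma α)⁻¹ * (Real.sqrt t ^ (α - 1))⁻¹ * g (Real.sqrt t * x) := by
    intro x hx
    have hx0 : 0 < x := hx
    have h1 : Real.sqrt t * x * v = (u - 1) * x := by
      rw [hv]; field_simp
    have h2 : 0 < Real.sqrt t ^ (α - 1) := Real.rpow_pos_of_pos hs _
    simp only [hg]
    rw [h1, mul_pow, Real.sq_sqrt ht.le, Real.mul_rpow hs.le hx0.le,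
      show -(t * x ^ 2) + u * x = -(t * x ^ 2) + (u - 1) * x + x by ring, Real.exp_add _ x,
      Real.exp_add, Real.exp_neg x]
    have := Real.exp_pos x
    field_simp
  rw [lintegral_gammaMeasure (by fun_prop)]
  have hint : IntegrableOn (fun x => (Real.Gamma α)⁻¹ * (Real.sqrt t ^ (α - 1))⁻¹ *
      g (Real.sqrt t * x)) (Ioi 0) := by
    refine Integrable.const_mul ?_ _
    refine (integrableOn_Ioi_comp_mul_left_iff g 0 hs).2 ?_
    rw [mul_zero]
    exact integrableOn_gammaM_integrand hα v
  have hcongr : ∫⁻ x in Ioi (0 : ℝ), ENNReal.ofReal ((Real.Gamma α)⁻¹ * x ^ (α - 1) *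
      Real.exp (-x)) * ENNReal.ofReal (Real.exp (-(t * x ^ 2) + u * x)) =
      ∫⁻ x in Ioi (0 : ℝ), ENNReal.ofReal ((Real.Gamma α)⁻¹ * (Real.sqrt t ^ (α - 1))⁻¹ *
        g (Real.sqrt t * x)) := by
    refine setLIntegral_congr_fun measurableSet_Ioi fun x hx => ?_
    have hx0 : 0 < x := hx
    rw [← hgx x hx, ← ENNReal.ofReal_mul (by positivity)]
  rw [hcongr, ← ofReal_integral_eq_lintegral_ofReal hint]
  · congr 1
    rw [integral_const_mul, integral_comp_mul_left_Ioi g 0 hs, mul_zero, smul_eq_mul, gammaM]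
    have h3 : (Real.sqrt t ^ (α - 1))⁻¹ * (Real.sqrt t)⁻¹ = t ^ (-(α / 2)) := by
      rw [← mul_inv, ← Real.rpow_add_one hs.ne', Real.sqrt_eq_rpow, ← Real.rpow_mul ht.le,
        ← Real.rpow_neg ht.le]
      congr 1
      ring
    rw [← h3]
    ring
  · filter_upwards [ae_restrict_mem measurableSet_Ioi] with x hx
    have hx0 : 0 < x := hx
    simp only [hg, Pi.zero_apply]
    positivity

lemma lintegral_gaussianReal_exp (u : ℝ) :
    ∫⁻ z, ENNReal.ofReal (Real.exp (u * z)) ∂gaussianReal 0 1 =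
      ENNReal.ofReal (Real.exp (u ^ 2 / 2)) := by
  rw [← ofReal_integral_eq_lintegral_ofReal (integrable_exp_mul_gaussianReal u)
    (ae_of_all _ fun _ => (Real.exp_pos _).le)]
  have h := congrFun (mgf_id_gaussianReal (μ := 0) (v := 1)) u
  simp only [mgf, id, zero_mul, zero_add, NNReal.coe_one, one_mul] at h
  rw [h]

lemma lintegral_gaussianReal {f : ℝ → ENNReal} (hf : Measurable f) :
    ∫⁻ z, f z ∂gaussianReal 0 1 = ∫⁻ z, ENNReal.ofReal (gaussianPDFReal 0 1 z) * f z := by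
  rw [gaussianReal_of_var_ne_zero 0 one_ne_zero,
    lintegral_withDensity_eq_lintegral_mul _ (measurable_gaussianPDF 0 1) hf]
  rfl

lemma lintegral_pi_prod {ι : Type*} [Fintype ι] {μ : ι → Measure ℝ}
    [∀ i, IsProbabilityMeasure (μ i)] {f : ι → ℝ → ENNReal} (hf : ∀ i, Measurable (f i)) :
    ∫⁻ y, ∏ i, f i (y i) ∂Measure.pi μ = ∏ i, ∫⁻ x, f i x ∂μ i := by
  rw [lintegral_prod_eq_prod_lintegral_of_indepFun _ _
    (iIndepFun_pi fun i => (hf i).aemeasurable) fun i => (hf i).comp (measurable_pi_apply i)]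
  exact Finset.prod_congr rfl fun i _ => (measurePreserving_eval μ i).lintegral_comp (hf i)

/-- The quadratic form `∑ (yᵢ - ȳ)²` on `ℝⁿ`. -/
noncomputable def sumSqDev {n : ℕ} (y : Fin n → ℝ) : ℝ := sampleQ (fun i (y : Fin n → ℝ) => y i) y

lemma sumSqDev_nonneg {n : ℕ} (y : Fin n → ℝ) : 0 ≤ sumSqDev y := by
  unfold sumSqDev sampleQ
  positivity

lemma measurable_sumSqDev {n : ℕ} : Measurable (sumSqDev (n := n)) := by
  unfold sumSqDev sampleQ sampleMean
  fun_prop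

lemma sumSqDev_eq {n : ℕ} (hn : n ≠ 0) (y : Fin n → ℝ) :
    sumSqDev y = ∑ i, y i ^ 2 - (∑ i, y i) ^ 2 / n := by
  have hn' : (n : ℝ) ≠ 0 := by exact_mod_cast hn
  simp only [sumSqDev, sampleQ, sampleMean, sub_sq, Finset.sum_add_distrib, Finset.sum_sub_distrib,
    ← Finset.sum_mul, ← Finset.mul_sum, Finset.sum_const, Finset.card_univ, Fintype.card_fin,
    nsmul_eq_mul]
  field_simp
  ring

lemma sq_sub_le_sumSqDev {n : ℕ} (y : Fin n → ℝ) {i j : Fin n} (hij : i ≠ j) :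
    (y i - y j) ^ 2 / 2 ≤ sumSqDev y := by
  have h : ∑ k ∈ {i, j}, (y k - sampleMean (fun i (y : Fin n → ℝ) => y i) y) ^ 2 ≤ sumSqDev y :=
    Finset.sum_le_univ_sum_of_nonneg fun _ => sq_nonneg _
  rw [Finset.sum_pair hij] at h
  refine le_trans ?_ h
  nlinarith [sq_nonneg (y i + y j - 2 * sampleMean (fun i (y : Fin n → ℝ) => y i) y)]

/-- The weight against which the kernel is integrated: the product of the `gammaM (α i)` at
`√(2/n) z` and the standard normal density. -/
noncomputable def gammaWeight {n : ℕ} (α : Fin n → ℝ) (z : ℝ) : ℝ :=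
  (∏ i, gammaM (α i) (Real.sqrt (2 / n) * z)) * gaussianPDFReal 0 1 z

lemma gammaWeight_nonneg {n : ℕ} {α : Fin n → ℝ} (hα : ∀ i, 0 < α i) (z : ℝ) :
    0 ≤ gammaWeight α z :=
  mul_nonneg (Finset.prod_nonneg fun i _ => gammaM_nonneg (hα i) _) (gaussianPDFReal_nonneg _ _ _)

lemma measurable_gammaWeight {n : ℕ} (α : Fin n → ℝ) : Measurable (gammaWeight α) :=
  (Finset.measurable_fun_prod _ fun _ _ => (measurable_gammaM _).comp (measurable_const_mul _)).mul
    (measurable_gaussianPDFReal 0 1)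

lemma gaussianPDFReal_zero_one_add (z a : ℝ) :
    gaussianPDFReal 0 1 (z + a) = gaussianPDFReal 0 1 z * Real.exp (-(z * a) - a ^ 2 / 2) := by
  simp only [gaussianPDFReal, mul_assoc, ← Real.exp_add, NNReal.coe_one]
  congr 3
  ring

/-- The Laplace transform of `∑ (yᵢ - ȳ)²` under a product of gamma laws. The term `(∑ yᵢ)² / n` is
linearised by a Gaussian integral, which makes the coordinates independent. -/
lemma lintegral_exp_neg_sumSqDev {n : ℕ} (hn : n ≠ 0) {α : Fin n → ℝ} (hα : ∀ i, 0 < α i)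
    {t : ℝ} (ht : 0 < t) :
    ∫⁻ y, ENNReal.ofReal (Real.exp (-(t * sumSqDev y)))
        ∂Measure.pi (fun i => gammaMeasure (α i) 1) =
      ENNReal.ofReal (t ^ (-((∑ i, α i) / 2))) * ∫⁻ z, ENNReal.ofReal (gammaWeight α z *
        Real.exp (-(z * (Real.sqrt (n / 2) / Real.sqrt t)) -
          (Real.sqrt (n / 2) / Real.sqrt t) ^ 2 / 2)) := by
  have hprob : ∀ i, IsProbabilityMeasure (gammaMeasure (α i) 1) := fun i =>
    isProbabilityMeasure_gammaMeasure (hα i) one_pos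
  have hn0 : (0 : ℝ) < n := by exact_mod_cast Nat.pos_of_ne_zero hn
  have hs : 0 < Real.sqrt t := Real.sqrt_pos.2 ht
  set c := Real.sqrt (2 / n) with hc
  have hc2 : c ^ 2 = 2 / n := Real.sq_sqrt (by positivity)
  have hc0 : 0 < c := Real.sqrt_pos.2 (by positivity)
  set a := Real.sqrt (n / 2) / Real.sqrt t with ha
  have hca : c * a = 1 / Real.sqrt t := by
    rw [ha, ← mul_div_assoc, hc, ← Real.sqrt_mul (by positivity),
      show (2 : ℝ) / n * (n / 2) = 1 by field_simp, Real.sqrt_one]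
  have h1 : ∀ y : Fin n → ℝ, ENNReal.ofReal (Real.exp (-(t * sumSqDev y))) =
      ∫⁻ z, ∏ i, ENNReal.ofReal (Real.exp (-(t * y i ^ 2) + (c * Real.sqrt t * z) * y i))
        ∂gaussianReal 0 1 := by
    intro y
    have h2 : ∀ z, ∏ i, ENNReal.ofReal (Real.exp (-(t * y i ^ 2) + (c * Real.sqrt t * z) * y i)) =
        ENNReal.ofReal (Real.exp (-(t * ∑ i, y i ^ 2))) *
          ENNReal.ofReal (Real.exp ((c * Real.sqrt t * ∑ i, y i) * z)) := by
      intro z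
      rw [← ENNReal.ofReal_prod_of_nonneg fun _ _ => (Real.exp_pos _).le, ← Real.exp_sum,
        ← ENNReal.ofReal_mul (Real.exp_pos _).le, ← Real.exp_add, Finset.sum_add_distrib,
        Finset.sum_neg_distrib, ← Finset.mul_sum, ← Finset.mul_sum]
      congr 3
      ring
    simp_rw [h2]
    rw [lintegral_const_mul _ (by fun_prop), lintegral_gaussianReal_exp,
      ← ENNReal.ofReal_mul (Real.exp_pos _).le, ← Real.exp_add, sumSqDev_eq hn]
    congr 2
    rw [mul_pow, mul_pow, hc2, Real.sq_sqrt ht.le]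
    field_simp
    ring
  simp_rw [h1]
  rw [lintegral_lintegral_swap]
  swap
  · refine Measurable.aemeasurable ?_
    unfold Function.uncurry
    fun_prop
  have h3 : ∀ z, ∫⁻ y, ∏ i, ENNReal.ofReal
      (Real.exp (-(t * y i ^ 2) + (c * Real.sqrt t * z) * y i))
        ∂Measure.pi (fun i => gammaMeasure (α i) 1) =
      ENNReal.ofReal (t ^ (-((∑ i, α i) / 2))) *
        ENNReal.ofReal (∏ i, gammaM (α i) (c * (z - a))) := by
    intro z
    rw [lintegral_pi_prod
      (f := fun _ x => ENNReal.ofReal (Real.exp (-(t * x ^ 2) + (c * Real.sqrt t * z) * x)))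
      fun i => by fun_prop]
    have h4 : (c * Real.sqrt t * z - 1) / Real.sqrt t = c * (z - a) := by
      rw [mul_sub, hca]
      field_simp
    simp_rw [lintegral_gammaMeasure_exp (hα _) ht, h4]
    rw [← ENNReal.ofReal_prod_of_nonneg fun i _ =>
      mul_nonneg (by positivity) (gammaM_nonneg (hα i) _), Finset.prod_mul_distrib,
      ENNReal.ofReal_mul (Finset.prod_nonneg fun _ _ => by positivity),
      ← Real.rpow_sum_of_pos ht, Finset.sum_neg_distrib, Finset.sum_div]
  have hm : Measurable fun z => ENNReal.ofReal (∏ i, gammaM (α i) (c * (z - a))) := by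
    refine ENNReal.measurable_ofReal.comp (Finset.measurable_fun_prod _ fun i _ => ?_)
    exact (measurable_gammaM _).comp (by fun_prop)
  simp_rw [h3]
  rw [lintegral_const_mul _ hm, lintegral_gaussianReal hm,
    ← lintegral_add_right_eq_self (μ := volume) _ a]
  congr 1
  refine lintegral_congr fun z => ?_
  rw [add_sub_cancel_right, ← ENNReal.ofReal_mul (gaussianPDFReal_nonneg _ _ _),
    gaussianPDFReal_zero_one_add, gammaWeight]
  congr 1
  ring

/-- A gamma density lies in `L^p` with `p = 1 + α`, so by Hölder's inequality Gaussian averages at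
scale `t ^ (-1/2)` decay like a power of `t`, uniformly in the centre. -/
lemma exists_lintegral_gammaMeasure_gaussian_le {α : ℝ} (hα : 0 < α) :
    ∃ C : ℝ, 0 ≤ C ∧ ∀ t : ℝ, 0 < t → ∀ y : ℝ,
      ∫⁻ x, ENNReal.ofReal (Real.exp (-(t / 2 * (x - y) ^ 2))) ∂gammaMeasure α 1 ≤
        ENNReal.ofReal (C * t ^ (-(α / (2 * (1 + α))))) := by
  have hΓ := Real.Gamma_pos_of_pos hα
  set p := 1 + α with hp
  set q := (1 + α) / α with hq
  have hq0 : 0 < q := by positivity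
  have hpq : p.HolderConjugate q := by
    refine Real.holderConjugate_iff.2 ⟨by linarith, ?_⟩
    rw [hp, hq]
    field_simp
  set I := (∫⁻ x in Ioi (0 : ℝ), ENNReal.ofReal ((Real.Gamma α)⁻¹ * x ^ (α - 1) *
      Real.exp (-x)) ^ p) ^ (1 / p) with hI
  have hItop : I ≠ ⊤ := by
    refine ENNReal.rpow_ne_top_of_nonneg (by positivity) ?_
    have hcongr : ∫⁻ x in Ioi (0 : ℝ), ENNReal.ofReal ((Real.Gamma α)⁻¹ * x ^ (α - 1) *
        Real.exp (-x)) ^ p = ∫⁻ x in Ioi (0 : ℝ), ENNReal.ofReal (((Real.Gamma α)⁻¹) ^ p *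
          (x ^ ((α - 1) * p) * Real.exp (-p * x ^ (1 : ℝ)))) := by
      refine setLIntegral_congr_fun measurableSet_Ioi fun x hx => ?_
      have hx0 : 0 < x := hx
      rw [ENNReal.ofReal_rpow_of_nonneg (by positivity) (by positivity),
        Real.mul_rpow (by positivity) (by positivity), Real.mul_rpow (by positivity) (by positivity),
        ← Real.rpow_mul hx0.le, ← Real.exp_mul, Real.rpow_one]
      congr 1
      rw [mul_assoc]
      congr 3
      ring
    rw [hcongr]
    -- the exponent is `(α - 1) (1 + α) = α ^ 2 - 1 > -1`
    have hint := integrableOn_rpow_mul_exp_neg_mul_rpow (p := 1) (s := (α - 1) * p) (b := p)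
      (by rw [hp]; nlinarith) one_pos (by positivity)
    exact (Integrable.const_mul hint _).lintegral_lt_top.ne
  refine ⟨I.toReal * (2 * Real.pi / q) ^ (1 / (2 * q)), by positivity, fun t ht y => ?_⟩
  rw [lintegral_gammaMeasure (by fun_prop)]
  refine (ENNReal.lintegral_mul_le_Lp_mul_Lq _ hpq (by fun_prop) (by fun_prop)).trans ?_
  have hgauss : ∫⁻ x in Ioi (0 : ℝ), ENNReal.ofReal (Real.exp (-(t / 2 * (x - y) ^ 2))) ^ q ≤
      ENNReal.ofReal (Real.sqrt (Real.pi / (q * t / 2))) := by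
    refine (setLIntegral_le_lintegral _ _).trans (le_of_eq ?_)
    rw [← lintegral_add_right_eq_self (μ := volume) _ y]
    have : ∀ x : ℝ, ENNReal.ofReal (Real.exp (-(t / 2 * (x + y - y) ^ 2))) ^ q =
        ENNReal.ofReal (Real.exp (-(q * t / 2) * x ^ 2)) := by
      intro x
      rw [ENNReal.ofReal_rpow_of_nonneg (Real.exp_pos _).le hq0.le, ← Real.exp_mul]
      congr 2
      ring
    simp_rw [this]
    rw [← integral_gaussian, ofReal_integral_eq_lintegral_ofReal
      (integrable_exp_neg_mul_sq (by positivity)) (ae_of_all _ fun _ => (Real.exp_pos _).le)]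
  calc I * (∫⁻ x in Ioi (0 : ℝ), ENNReal.ofReal (Real.exp (-(t / 2 * (x - y) ^ 2))) ^ q) ^ (1 / q)
      ≤ ENNReal.ofReal I.toReal *
        ENNReal.ofReal (Real.sqrt (Real.pi / (q * t / 2))) ^ (1 / q) := by
        rw [ENNReal.ofReal_toReal hItop]
        gcongr
    _ = _ := by
        rw [ENNReal.ofReal_rpow_of_nonneg (by positivity) (by positivity),
          ← ENNReal.ofReal_mul (by positivity), mul_assoc]
        congr 2
        rw [Real.sqrt_eq_rpow, ← Real.rpow_mul (by positivity),
          show Real.pi / (q * t / 2) = (2 * Real.pi / q) * t⁻¹ by field_simp,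
          Real.mul_rpow (by positivity) (by positivity), Real.inv_rpow ht.le, ← Real.rpow_neg ht.le]
        congr 2
        · field_simp
        · rw [hq, hp]
          field_simp

lemma exists_lintegral_exp_neg_sumSqDev_le {n : ℕ} {α : Fin n → ℝ} (hα : ∀ i, 0 < α i)
    {i j : Fin n} (hij : i ≠ j) :
    ∃ C : ℝ, 0 ≤ C ∧ ∀ t : ℝ, 0 < t →
      ∫⁻ y, ENNReal.ofReal (Real.exp (-(t * sumSqDev y)))
        ∂Measure.pi (fun i => gammaMeasure (α i) 1) ≤
        ENNReal.ofReal (C * t ^ (-(α i / (2 * (1 + α i))))) := by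
  have hprob : ∀ i, IsProbabilityMeasure (gammaMeasure (α i) 1) := fun i =>
    isProbabilityMeasure_gammaMeasure (hα i) one_pos
  obtain ⟨C, hC, h⟩ := exists_lintegral_gammaMeasure_gaussian_le (hα i)
  refine ⟨C, hC, fun t ht => ?_⟩
  set ν := Measure.pi (fun i => gammaMeasure (α i) 1)
  have hind : IndepFun (fun y : Fin n → ℝ => y j) (fun y => y i) ν :=
    (iIndepFun_pi (μ := fun i => gammaMeasure (α i) 1) (X := fun _ x => x)
      fun _ => aemeasurable_id).indepFun hij.symm
  have hlaw : HasLaw (fun y : Fin n → ℝ => (y j, y i))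
      ((gammaMeasure (α j) 1).prod (gammaMeasure (α i) 1)) ν :=
    IndepFun.hasLaw_prod
      (measurePreserving_eval (fun i => gammaMeasure (α i) 1) j).hasLaw
      (measurePreserving_eval (fun i => gammaMeasure (α i) 1) i).hasLaw hind
  calc ∫⁻ y, ENNReal.ofReal (Real.exp (-(t * sumSqDev y))) ∂ν
      ≤ ∫⁻ y, ENNReal.ofReal (Real.exp (-(t / 2 * (y i - y j) ^ 2))) ∂ν := by
        refine lintegral_mono fun y => ENNReal.ofReal_le_ofReal (Real.exp_le_exp.2 ?_)
        have := mul_le_mul_of_nonneg_left (sq_sub_le_sumSqDev y hij) ht.le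
        linarith
    _ = ∫⁻ z, ENNReal.ofReal (Real.exp (-(t / 2 * (z.2 - z.1) ^ 2)))
          ∂(gammaMeasure (α j) 1).prod (gammaMeasure (α i) 1) :=
        hlaw.lintegral_comp
          (f := fun z : ℝ × ℝ => ENNReal.ofReal (Real.exp (-(t / 2 * (z.2 - z.1) ^ 2))))
          (by fun_prop)
    _ = ∫⁻ a, ∫⁻ b, ENNReal.ofReal (Real.exp (-(t / 2 * (b - a) ^ 2)))
          ∂gammaMeasure (α i) 1 ∂gammaMeasure (α j) 1 := lintegral_prod _ (by fun_prop)
    _ ≤ ∫⁻ _, ENNReal.ofReal (C * t ^ (-(α i / (2 * (1 + α i))))) ∂gammaMeasure (α j) 1 :=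
        lintegral_mono fun a => h t ht a
    _ = _ := by simp

/-! ### The kernel integrated against a weight -/

lemma measurable_rpow_mul_kernelK {β κ : ℝ} (hβ : 0 < β) (hκ : 0 ≤ κ) :
    Measurable fun p : ℝ × ℝ => p.1 ^ (β - 1) * kernelK β (κ * Real.sqrt p.1) p.2 :=
  (measurable_fst.pow_const _).mul
    (measurable_kernelK_comp hβ (by fun_prop) (fun _ => by positivity) (by fun_prop))

lemma continuousOn_rpow_mul_kernelK {β κ : ℝ} (hβ : 0 < β) (hκ : 0 ≤ κ) (z : ℝ) :
    ContinuousOn (fun x => x ^ (β - 1) * kernelK β (κ * Real.sqrt x) z) (Ioi 0) := by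
  refine ContinuousOn.mul (fun x hx => ?_) ?_
  · exact (Real.continuousAt_rpow_const x _ (Or.inl (ne_of_gt hx))).continuousWithinAt
  · exact (continuousOn_kernelK hβ z).comp (by fun_prop) fun x _ => by
      simp only [mem_Ici]; positivity

/-- The function of `z` dominating the kernel `x ^ (β - 1) K_β(κ √x, z)`, up to a factor `exp x`. -/
noncomputable def kernelMajorant (β κ z : ℝ) : ENNReal :=
  ∫⁻ ξ, ENNReal.ofReal (‖verticalLine ξ‖ ^ (-β) *
    Real.exp (-(κ * (verticalLine ξ ^ (-(1 / 2) : ℂ)).re * z)))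

lemma measurable_kernelMajorant_integrand (β κ : ℝ) : Measurable fun p : ℝ × ℝ =>
    ENNReal.ofReal (‖verticalLine p.2‖ ^ (-β) *
      Real.exp (-(κ * (verticalLine p.2 ^ (-(1 / 2) : ℂ)).re * p.1))) := by
  have h1 := (continuous_norm_verticalLine_rpow (-β)).measurable
  have h2 := (Complex.continuous_re.comp (continuous_verticalLine_cpow (-(1 / 2)))).measurable
  have h3 := h2.comp (measurable_snd : Measurable (Prod.snd : ℝ × ℝ → ℝ))
  exact ENNReal.measurable_ofReal.comp ((h1.comp measurable_snd).mul
    (((h3.const_mul κ).mul measurable_fst).neg.exp))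

lemma measurable_kernelMajorant (β κ : ℝ) : Measurable (kernelMajorant β κ) :=
  (measurable_kernelMajorant_integrand β κ).lintegral_prod_right'

section Weight

variable {β κ ε C : ℝ} {w : ℝ → ℝ}

/-- Integrating the majorant against a weight whose tilted integrals are `O(t ^ (β - 1 - ε))`.
After Tonelli's theorem the tilt on the line `Re s = 1` is `κ / √t` with `t ≤ 2 ‖s‖`, so that what
remains is `∫ ‖s‖ ^ (-(1 + ε))`. -/
lemma lintegral_kernelMajorant_mul_lt_top (hε : 0 < ε) (hεβ : ε ≤ β - 1)
    (hC : 0 ≤ C) (hw : Measurable w) (hw0 : ∀ z, 0 ≤ w z)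
    (hbound : ∀ t : ℝ, 0 < t → ∫⁻ z, ENNReal.ofReal (w z *
      Real.exp (-(z * (κ / Real.sqrt t)) - (κ / Real.sqrt t) ^ 2 / 2)) ≤
        ENNReal.ofReal (C * t ^ (β - 1 - ε))) :
    ∫⁻ z, kernelMajorant β κ z * ENNReal.ofReal (w z) < ⊤ := by
  have hm := measurable_kernelMajorant_integrand β κ
  have hmw : Measurable fun z => ENNReal.ofReal (w z) := hw.ennreal_ofReal
  have h1 : ∀ z, kernelMajorant β κ z * ENNReal.ofReal (w z) =
      ∫⁻ ξ, ENNReal.ofReal (‖verticalLine ξ‖ ^ (-β) *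
        Real.exp (-(κ * (verticalLine ξ ^ (-(1 / 2) : ℂ)).re * z))) * ENNReal.ofReal (w z) :=
    fun z => (lintegral_mul_const' _ _ ENNReal.ofReal_ne_top).symm
  simp_rw [h1]
  rw [lintegral_lintegral_swap (hm.mul (hmw.comp measurable_fst)).aemeasurable]
  have hint : Integrable fun ξ => C * Real.exp (κ ^ 2 / 2) * 2 ^ (β - 1 - ε) *
      ‖verticalLine ξ‖ ^ (-(1 + ε)) :=
    (integrable_norm_verticalLine_rpow (by linarith)).const_mul _
  refine lt_of_le_of_lt (lintegral_mono fun ξ => ?_) hint.lintegral_lt_top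
  -- the tilt `κ ρ` equals `κ / √t` for `t = ρ ^ (-2)`, and `1 ≤ t ≤ 2 ‖s‖`
  set ρ := (verticalLine ξ ^ (-(1 / 2) : ℂ)).re with hρ
  have hρ0 : 0 < ρ := re_verticalLine_cpow_neg_half_pos ξ
  have hρ1 : ρ ≤ 1 := re_verticalLine_cpow_neg_half_le ξ
  have hs0 : 0 < ‖verticalLine ξ‖ := one_pos.trans_le (one_le_norm_verticalLine ξ)
  have ht0 : 0 < (ρ ^ 2)⁻¹ := by positivity
  have hsqrt : κ / Real.sqrt (ρ ^ 2)⁻¹ = κ * ρ := by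
    rw [Real.sqrt_inv, Real.sqrt_sq hρ0.le, div_inv_eq_mul]
  have ht : (ρ ^ 2)⁻¹ ≤ 2 * ‖verticalLine ξ‖ := by
    have h := norm_sq_le_two_mul_re_sq ξ
    rw [Real.rpow_neg_one, ← hρ] at h
    rw [inv_le_comm₀ (by positivity) (by positivity), mul_inv]
    linarith
  calc ∫⁻ z, ENNReal.ofReal (‖verticalLine ξ‖ ^ (-β) * Real.exp (-(κ * ρ * z))) *
        ENNReal.ofReal (w z)
      ≤ ∫⁻ z, ENNReal.ofReal (‖verticalLine ξ‖ ^ (-β) * Real.exp (κ ^ 2 / 2)) *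
        ENNReal.ofReal (w z * Real.exp (-(z * (κ * ρ)) - (κ * ρ) ^ 2 / 2)) := by
        refine lintegral_mono fun z => ?_
        rw [← ENNReal.ofReal_mul (by positivity), ← ENNReal.ofReal_mul (by positivity)]
        refine ENNReal.ofReal_le_ofReal ?_
        have h2 : Real.exp (-(κ * ρ * z)) ≤
            Real.exp (κ ^ 2 / 2) * Real.exp (-(z * (κ * ρ)) - (κ * ρ) ^ 2 / 2) := by
          rw [← Real.exp_add, Real.exp_le_exp, mul_pow]
          have : ρ ^ 2 ≤ 1 := pow_le_one₀ hρ0.le hρ1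
          nlinarith [sq_nonneg κ]
        calc _ ≤ ‖verticalLine ξ‖ ^ (-β) *
              (Real.exp (κ ^ 2 / 2) * Real.exp (-(z * (κ * ρ)) - (κ * ρ) ^ 2 / 2)) * w z := by
              gcongr
              exact hw0 z
          _ = _ := by ring
    _ ≤ ENNReal.ofReal (‖verticalLine ξ‖ ^ (-β) * Real.exp (κ ^ 2 / 2)) *
        ENNReal.ofReal (C * ((ρ ^ 2)⁻¹) ^ (β - 1 - ε)) := by
        rw [lintegral_const_mul' _ _ ENNReal.ofReal_ne_top]
        gcongr
        have h := hbound _ ht0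
        rwa [hsqrt] at h
    _ ≤ _ := by
        rw [← ENNReal.ofReal_mul (by positivity)]
        refine ENNReal.ofReal_le_ofReal ?_
        calc ‖verticalLine ξ‖ ^ (-β) * Real.exp (κ ^ 2 / 2) * (C * ((ρ ^ 2)⁻¹) ^ (β - 1 - ε))
            ≤ ‖verticalLine ξ‖ ^ (-β) * Real.exp (κ ^ 2 / 2) *
              (C * (2 * ‖verticalLine ξ‖) ^ (β - 1 - ε)) := by
              gcongr
          _ = _ := by
              rw [Real.mul_rpow two_pos.le hs0.le, show -(1 + ε) = -β + (β - 1 - ε) by ring,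
                Real.rpow_add hs0]
              ring

/-- The kernel integrated against the weight `w`. -/
noncomputable def kernelTransform (β κ : ℝ) (w : ℝ → ℝ) (x : ℝ) : ℝ :=
  ∫ z, x ^ (β - 1) * kernelK β (κ * Real.sqrt x) z * w z

lemma integrable_toReal_kernelMajorant_mul (hw : Measurable w)
    (hfin : ∫⁻ z, kernelMajorant β κ z * ENNReal.ofReal (w z) < ⊤) :
    Integrable fun z => (kernelMajorant β κ z * ENNReal.ofReal (w z)).toReal :=
  integrable_toReal_of_lintegral_ne_top
    ((measurable_kernelMajorant β κ).mul hw.ennreal_ofReal).aemeasurable hfin.ne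

lemma ae_norm_kernelK_mul_le (hβ : 1 < β) (hκ : 0 ≤ κ) (hw : Measurable w) (hw0 : ∀ z, 0 ≤ w z)
    (hfin : ∫⁻ z, kernelMajorant β κ z * ENNReal.ofReal (w z) < ⊤) :
    ∀ᵐ z, ∀ x : ℝ, 0 < x → ‖x ^ (β - 1) * kernelK β (κ * Real.sqrt x) z * w z‖ ≤
      Real.exp x * (kernelMajorant β κ z * ENNReal.ofReal (w z)).toReal := by
  have hm : Measurable fun z => kernelMajorant β κ z * ENNReal.ofReal (w z) :=
    (measurable_kernelMajorant β κ).mul hw.ennreal_ofReal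
  filter_upwards [ae_lt_top hm hfin.ne] with z hz x hx
  rw [norm_mul, Real.norm_of_nonneg (hw0 z), Real.norm_eq_abs,
    ← ENNReal.toReal_ofReal (Real.exp_pos x).le, ← ENNReal.toReal_mul,
    ← ENNReal.ofReal_le_iff_le_toReal (ENNReal.mul_ne_top ENNReal.ofReal_ne_top hz.ne),
    ENNReal.ofReal_mul (abs_nonneg _), ← mul_assoc]
  gcongr
  exact ofReal_abs_kernelK_le hβ hκ hx z

lemma integrable_kernelK_mul (hβ : 1 < β) (hκ : 0 ≤ κ) (hw : Measurable w) (hw0 : ∀ z, 0 ≤ w z)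
    (hfin : ∫⁻ z, kernelMajorant β κ z * ENNReal.ofReal (w z) < ⊤) {x : ℝ} (hx : 0 < x) :
    Integrable fun z => x ^ (β - 1) * kernelK β (κ * Real.sqrt x) z * w z := by
  refine ((integrable_toReal_kernelMajorant_mul hw hfin).const_mul (Real.exp x)).mono' ?_ ?_
  · exact (((measurable_rpow_mul_kernelK (by linarith) hκ).comp
      (measurable_const.prodMk measurable_id)).mul hw).aestronglyMeasurable
  · filter_upwards [ae_norm_kernelK_mul_le hβ hκ hw hw0 hfin] with z hz using hz x hx

lemma continuousOn_kernelTransform (hβ : 1 < β) (hκ : 0 ≤ κ) (hw : Measurable w)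
    (hw0 : ∀ z, 0 ≤ w z) (hfin : ∫⁻ z, kernelMajorant β κ z * ENNReal.ofReal (w z) < ⊤) :
    ContinuousOn (kernelTransform β κ w) (Ioi 0) := by
  intro x hx
  have hx0 : 0 < x := hx
  refine ContinuousAt.continuousWithinAt ?_
  refine continuousAt_of_dominated
    (bound := fun z => Real.exp (x + 1) * (kernelMajorant β κ z * ENNReal.ofReal (w z)).toReal)
    ?_ ?_ ((integrable_toReal_kernelMajorant_mul hw hfin).const_mul _) (ae_of_all _ fun z => ?_)
  · filter_upwards [Ioi_mem_nhds hx0] with y hy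
    exact (integrable_kernelK_mul hβ hκ hw hw0 hfin hy).aestronglyMeasurable
  · filter_upwards [Ioi_mem_nhds hx0, Iio_mem_nhds (lt_add_one x)] with y hy0 hy1
    filter_upwards [ae_norm_kernelK_mul_le hβ hκ hw hw0 hfin] with z hz
    refine (hz y hy0).trans ?_
    gcongr
    exact le_of_lt hy1
  · exact ((continuousOn_rpow_mul_kernelK (by linarith) hκ z).continuousAt
      (Ioi_mem_nhds hx0)).mul_const _

lemma integrable_prod_exp_mul_kernelK (hβ : 1 < β) (hκ : 0 ≤ κ) (hw : Measurable w)
    (hw0 : ∀ z, 0 ≤ w z) (hfin : ∫⁻ z, kernelMajorant β κ z * ENNReal.ofReal (w z) < ⊤)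
    {t : ℝ} (ht : 1 < t) :
    Integrable (fun p : ℝ × ℝ => Real.exp (-(t * p.1)) *
      (p.1 ^ (β - 1) * kernelK β (κ * Real.sqrt p.1) p.2 * w p.2))
      ((volume.restrict (Ioi 0)).prod volume) := by
  have h1 : Integrable (fun x => Real.exp (-(t - 1) * x)) (volume.restrict (Ioi 0)) :=
    exp_neg_integrableOn_Ioi 0 (by linarith)
  refine (h1.mul_prod (integrable_toReal_kernelMajorant_mul hw hfin)).mono' ?_ ?_
  · refine Measurable.aestronglyMeasurable ?_
    exact (by fun_prop : Measurable fun p : ℝ × ℝ => Real.exp (-(t * p.1))).mul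
      ((measurable_rpow_mul_kernelK (by linarith) hκ).mul (hw.comp measurable_snd))
  · have hx : ∀ᵐ p : ℝ × ℝ ∂(volume.restrict (Ioi 0)).prod volume, p.1 ∈ Ioi (0 : ℝ) :=
      Measure.quasiMeasurePreserving_fst.ae (ae_restrict_mem measurableSet_Ioi)
    have hz := Measure.quasiMeasurePreserving_snd (μ := volume.restrict (Ioi (0 : ℝ))).ae
      (ae_norm_kernelK_mul_le hβ hκ hw hw0 hfin)
    filter_upwards [hx, hz] with p hp1 hp2
    rw [norm_mul, Real.norm_of_nonneg (Real.exp_pos _).le]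
    calc _ ≤ Real.exp (-(t * p.1)) * (Real.exp p.1 *
          (kernelMajorant β κ p.2 * ENNReal.ofReal (w p.2)).toReal) := by
          gcongr
          exact hp2 p.1 hp1
      _ = _ := by
          rw [← mul_assoc, ← Real.exp_add]
          congr 2
          ring

lemma integrableOn_exp_mul_kernelTransform (hβ : 1 < β) (hκ : 0 ≤ κ) (hw : Measurable w)
    (hw0 : ∀ z, 0 ≤ w z) (hfin : ∫⁻ z, kernelMajorant β κ z * ENNReal.ofReal (w z) < ⊤)
    {t : ℝ} (ht : 1 < t) :
    IntegrableOn (fun x => Real.exp (-(t * x)) * kernelTransform β κ w x) (Ioi 0) := by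
  refine (integrable_prod_exp_mul_kernelK hβ hκ hw hw0 hfin ht).integral_prod_left.congr
    (ae_of_all _ fun x => ?_)
  simp only [kernelTransform, integral_const_mul]

lemma integral_exp_mul_kernelTransform (hβ : 1 < β) (hκ : 0 ≤ κ) (hw : Measurable w)
    (hw0 : ∀ z, 0 ≤ w z) (hfin : ∫⁻ z, kernelMajorant β κ z * ENNReal.ofReal (w z) < ⊤)
    {t : ℝ} (ht : 1 < t) :
    ∫ x in Ioi (0 : ℝ), Real.exp (-(t * x)) * kernelTransform β κ w x =
      t ^ (-β) * ∫ z, w z *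
        Real.exp (-(z * (κ / Real.sqrt t)) - (κ / Real.sqrt t) ^ 2 / 2) := by
  have h := integral_integral_swap (f := fun x z => Real.exp (-(t * x)) *
    (x ^ (β - 1) * kernelK β (κ * Real.sqrt x) z * w z)) (integrable_prod_exp_mul_kernelK hβ hκ hw hw0 hfin ht)
  simp only [integral_const_mul] at h
  simp only [kernelTransform]
  rw [h, ← integral_const_mul]
  refine integral_congr_ae (ae_of_all _ fun z => ?_)
  simp only [← mul_assoc]
  rw [integral_mul_const]
  have h2 := integral_exp_mul_kernelK (by linarith : 0 < β) hκ (by linarith : 0 < t) z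
  simp only [← mul_assoc] at h2
  rw [h2]
  ring

end Weight

/-! ### Uniqueness of Laplace transforms -/

lemma integral_withDensity_ofReal {E : Type*} [NormedAddCommGroup E] [NormedSpace ℝ E]
    {μ : Measure ℝ} {f : ℝ → ℝ} (hf : AEMeasurable f μ) (hf0 : 0 ≤ᵐ[μ] f) (g : ℝ → E) :
    ∫ x, g x ∂μ.withDensity (fun x => ENNReal.ofReal (f x)) = ∫ x, f x • g x ∂μ := by
  rw [integral_withDensity_eq_integral_toReal_smul₀ hf.ennreal_ofReal (by simp)]
  refine integral_congr_ae ?_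
  filter_upwards [hf0] with x hx
  rw [ENNReal.toReal_ofReal hx]

lemma integrable_withDensity_ofReal_iff {μ : Measure ℝ} {f : ℝ → ℝ} (hf : AEMeasurable f μ)
    (hf0 : 0 ≤ᵐ[μ] f) (g : ℝ → ℝ) :
    Integrable g (μ.withDensity fun x => ENNReal.ofReal (f x)) ↔
      Integrable (fun x => f x * g x) μ := by
  rw [show (fun x => ENNReal.ofReal (f x)) = fun x => ((f x).toNNReal : ENNReal) from rfl,
    integrable_withDensity_iff_integrable_smul₀ hf.real_toNNReal]
  refine integrable_congr ?_
  filter_upwards [hf0] with x hx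
  rw [NNReal.smul_def, Real.coe_toNNReal _ hx, smul_eq_mul]

/-- Uniqueness of the Laplace transform for nonnegative functions. -/
lemma ae_eq_of_forall_integral_exp_mul_eq_of_nonneg {f g : ℝ → ℝ} {c : ℝ}
    {μ : Measure ℝ} [SigmaFinite μ] (hf0 : 0 ≤ᵐ[μ] f) (hg0 : 0 ≤ᵐ[μ] g)
    (hf : ∀ t, c < t → Integrable (fun x => Real.exp (-(t * x)) * f x) μ)
    (hg : ∀ t, c < t → Integrable (fun x => Real.exp (-(t * x)) * g x) μ)
    (h : ∀ t, c < t → ∫ x, Real.exp (-(t * x)) * f x ∂μ = ∫ x, Real.exp (-(t * x)) * g x ∂μ) :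
    f =ᵐ[μ] g := by
  set t₀ := c + 1 with ht₀
  have hct : c < t₀ := by linarith
  -- the finite measures `exp (-t₀ x) f(x) μ(dx)` and `exp (-t₀ x) g(x) μ(dx)`
  set M : (ℝ → ℝ) → Measure ℝ := fun k =>
    μ.withDensity fun x => ENNReal.ofReal (Real.exp (-(t₀ * x)) * k x) with hM
  have hshift : ∀ (k : ℝ → ℝ) (u x : ℝ), Real.exp (-(t₀ * x)) * k x * Real.exp (u * x) =
      Real.exp (-((t₀ - u) * x)) * k x := by
    intro k u x
    rw [mul_right_comm, ← Real.exp_add]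
    congr 2
    ring
  have key : ∀ k : ℝ → ℝ, 0 ≤ᵐ[μ] k →
      (∀ t, c < t → Integrable (fun x => Real.exp (-(t * x)) * k x) μ) →
      IsFiniteMeasure (M k) ∧ Iio 1 ⊆ integrableExpSet id (M k) ∧
        ∀ u < 1, mgf id (M k) u = ∫ x, Real.exp (-((t₀ - u) * x)) * k x ∂μ := by
    intro k hk0 hk
    have hk0' : 0 ≤ᵐ[μ] fun x => Real.exp (-(t₀ * x)) * k x := by
      filter_upwards [hk0] with x hx using mul_nonneg (Real.exp_pos _).le hx
    have hkm := (hk t₀ hct).aestronglyMeasurable.aemeasurable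
    refine ⟨isFiniteMeasure_withDensity_ofReal (hk t₀ hct).2, fun u hu => ?_, fun u _ => ?_⟩
    · have hu1 : u < 1 := hu
      rw [integrableExpSet, mem_ofPred_eq]
      simp only [id]
      rw [integrable_withDensity_ofReal_iff hkm hk0']
      simp_rw [hshift]
      exact hk _ (by linarith)
    · simp only [mgf, id]
      rw [integral_withDensity_ofReal hkm hk0']
      simp_rw [smul_eq_mul, hshift]
  obtain ⟨hf1, hf2, hf3⟩ := key f hf0 hf
  obtain ⟨hg1, hg2, hg3⟩ := key g hg0 hg
  have han : ∀ m : Measure ℝ, Iio 1 ⊆ integrableExpSet id m →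
      AnalyticOnNhd ℂ (complexMGF id m) {z | z.re < 1} := fun m hm =>
    analyticOnNhd_complexMGF.mono fun z hz => interior_mono hm (by rw [interior_Iio]; exact hz)
  have heq := eqOn_halfPlane_of_eq_ofReal (han _ hf2) (han _ hg2) fun u hu => by
    rw [complexMGF_ofReal, complexMGF_ofReal, hf3 u hu, hg3 u hu, h _ (by linarith)]
  have hMeq : M f = M g := by
    refine Measure.ext_of_charFun (funext fun ξ => ?_)
    rw [← complexMGF_id_mul_I, ← complexMGF_id_mul_I]
    exact heq (by simp)
  have hfm := (hf t₀ hct).aestronglyMeasurable.aemeasurable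
  have hgm := (hg t₀ hct).aestronglyMeasurable.aemeasurable
  have hae := (withDensity_eq_iff_of_sigmaFinite hfm.ennreal_ofReal hgm.ennreal_ofReal).1 hMeq
  filter_upwards [hae, hf0, hg0] with x hx hfx hgx
  have hpos := Real.exp_pos (-(t₀ * x))
  rw [ENNReal.ofReal_eq_ofReal_iff (mul_nonneg hpos.le hfx) (mul_nonneg hpos.le hgx)] at hx
  exact mul_left_cancel₀ hpos.ne' hx

/-- Uniqueness of the Laplace transform. -/
lemma ae_eq_of_forall_integral_exp_mul_eq {f g : ℝ → ℝ} {c : ℝ}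
    {μ : Measure ℝ} [SigmaFinite μ]
    (hf : ∀ t, c < t → Integrable (fun x => Real.exp (-(t * x)) * f x) μ)
    (hg : ∀ t, c < t → Integrable (fun x => Real.exp (-(t * x)) * g x) μ)
    (h : ∀ t, c < t → ∫ x, Real.exp (-(t * x)) * f x ∂μ = ∫ x, Real.exp (-(t * x)) * g x ∂μ) :
    f =ᵐ[μ] g := by
  have hpos : ∀ t, c < t → Integrable (fun x => Real.exp (-(t * x)) * max (f x - g x) 0) μ := by
    intro t ht
    refine ((hf t ht).sub (hg t ht)).pos_part.congr (ae_of_all _ fun x => ?_)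
    simp only [Pi.sub_apply]
    rw [mul_max_of_nonneg _ _ (Real.exp_pos _).le, mul_zero, mul_sub]
  have hneg : ∀ t, c < t → Integrable (fun x => Real.exp (-(t * x)) * max (-(f x - g x)) 0) μ := by
    intro t ht
    refine ((hf t ht).sub (hg t ht)).neg_part.congr (ae_of_all _ fun x => ?_)
    simp only [Pi.sub_apply]
    rw [mul_max_of_nonneg _ _ (Real.exp_pos _).le, mul_zero, mul_neg, mul_sub]
  have hae := ae_eq_of_forall_integral_exp_mul_eq_of_nonneg
    (ae_of_all μ fun x => le_max_right (f x - g x) 0)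
    (ae_of_all μ fun x => le_max_right (-(f x - g x)) 0) hpos hneg fun t ht => by
      rw [← sub_eq_zero, ← integral_sub (hpos t ht) (hneg t ht)]
      have : ∀ x, Real.exp (-(t * x)) * max (f x - g x) 0 -
          Real.exp (-(t * x)) * max (-(f x - g x)) 0 =
          Real.exp (-(t * x)) * f x - Real.exp (-(t * x)) * g x := by
        intro x
        rw [← mul_sub, max_zero_sub_eq_self, mul_sub]
      simp_rw [this]
      rw [integral_sub (hf t ht) (hg t ht), h t ht, sub_self]
  filter_upwards [hae] with x hx
  have := max_zero_sub_eq_self (f x - g x)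
  rw [hx, sub_self] at this
  linarith

lemma lintegral_exp_mul_cdf {μ : Measure ℝ} [IsProbabilityMeasure μ] (hμ : ∀ᵐ q ∂μ, 0 ≤ q)
    {t : ℝ} (ht : 0 < t) :
    ∫⁻ x in Ioi (0 : ℝ), ENNReal.ofReal (Real.exp (-(t * x)) * cdf μ x) =
      ENNReal.ofReal t⁻¹ * ∫⁻ q, ENNReal.ofReal (Real.exp (-(t * q))) ∂μ := by
  have h1 : ∀ x, ENNReal.ofReal (Real.exp (-(t * x)) * cdf μ x) =
      ∫⁻ q, (Ici q).indicator (fun x => ENNReal.ofReal (Real.exp (-(t * x)))) x ∂μ := by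
    intro x
    rw [ENNReal.ofReal_mul (Real.exp_pos _).le, ofReal_cdf, ← lintegral_indicator_const
      measurableSet_Iic]
    rfl
  simp_rw [h1]
  rw [lintegral_lintegral_swap, ← lintegral_const_mul _ (by fun_prop)]
  · refine lintegral_congr_ae ?_
    filter_upwards [hμ] with q hq
    rw [lintegral_indicator measurableSet_Ici, Measure.restrict_restrict measurableSet_Ici]
    have h2 : volume.restrict (Ici q ∩ Ioi (0 : ℝ)) = volume.restrict (Ioi q) := by
      refine Measure.restrict_congr_set ?_
      rcases hq.eq_or_lt with rfl | hq
      · exact (inter_eq_right.2 Ioi_subset_Ici_self).eventuallyEq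
      · rw [inter_eq_left.2 (Ici_subset_Ioi.2 hq)]
        exact Ioi_ae_eq_Ici.symm
    have h3 : IntegrableOn (fun x => Real.exp (-(t * x))) (Ioi q) := by
      simpa only [neg_mul] using exp_neg_integrableOn_Ioi q ht
    rw [h2, ← ofReal_integral_eq_lintegral_ofReal h3 (ae_of_all _ fun _ => (Real.exp_pos _).le),
      ← ENNReal.ofReal_mul (by positivity)]
    congr 1
    have := integral_exp_mul_Ioi (neg_lt_zero.2 ht) q
    simp only [neg_mul] at this
    rw [this]
    field_simp
  · refine Measurable.aemeasurable ?_
    have : (Function.uncurry fun x q : ℝ =>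
        (Ici q).indicator (fun x => ENNReal.ofReal (Real.exp (-(t * x)))) x) =
        {p : ℝ × ℝ | p.2 ≤ p.1}.indicator fun p => ENNReal.ofReal (Real.exp (-(t * p.1))) := by
      ext p
      rfl
    rw [this]
    exact Measurable.indicator (by fun_prop) (measurableSet_le measurable_snd measurable_fst)

lemma integrableOn_exp_mul_cdf (μ : Measure ℝ) [IsProbabilityMeasure μ] {t : ℝ} (ht : 0 < t) :
    IntegrableOn (fun x => Real.exp (-(t * x)) * cdf μ x) (Ioi 0) := by
  have h3 : IntegrableOn (fun x => Real.exp (-(t * x))) (Ioi 0) := by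
    simpa only [neg_mul] using exp_neg_integrableOn_Ioi 0 ht
  refine Integrable.mono' h3 ?_ (ae_of_all _ fun x => ?_)
  · exact ((by fun_prop : Measurable fun x : ℝ => Real.exp (-(t * x))).mul
      (monotone_cdf μ).measurable).aestronglyMeasurable
  · rw [norm_mul, Real.norm_of_nonneg (Real.exp_pos _).le, Real.norm_of_nonneg (cdf_nonneg μ x)]
    exact mul_le_of_le_one_right (Real.exp_pos _).le (cdf_le_one μ x)

/-- Equality almost everywhere improves to equality everywhere, as a cdf is right-continuous. -/
lemma cdf_eq_of_ae_eq {μ : Measure ℝ} {g : ℝ → ℝ} (hg : ContinuousOn g (Ioi 0))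
    (h : cdf μ =ᵐ[volume.restrict (Ioi 0)] g) {x : ℝ} (hx : 0 < x) : cdf μ x = g x := by
  have h1 : Tendsto (cdf μ) (𝓝[>] x) (𝓝 (cdf μ x)) :=
    ((cdf μ).right_continuous x).mono_left (nhdsWithin_mono _ Ioi_subset_Ici_self)
  have h2 : Tendsto g (𝓝[>] x) (𝓝 (g x)) :=
    ((hg x hx).continuousAt (Ioi_mem_nhds hx)).tendsto.mono_left nhdsWithin_le_nhds
  refine tendsto_nhds_unique_of_frequently_eq h1 h2 fun hne => ?_
  obtain ⟨y, hxy, hy⟩ := mem_nhdsGT_iff_exists_Ioo_subset.1 hne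
  rw [EventuallyEq, ae_restrict_iff' measurableSet_Ioi, ae_iff] at h
  have h0 : volume (Ioo x y) = 0 := measure_mono_null (fun u hu (hu' : u ∈ Ioi 0 → _) =>
    hy hu (hu' (hx.trans hu.1))) h
  rw [Real.volume_Ioo, ENNReal.ofReal_eq_zero] at h0
  have : x < y := hxy
  linarith

/-! ### The distribution function -/

/-- The law of `∑ (Xᵢ - X̄)²` for independent standard gamma variables `Xᵢ` with shapes `α i`. -/
noncomputable def sumSqDevLaw {n : ℕ} (α : Fin n → ℝ) : Measure ℝ :=
  (Measure.pi fun i => gammaMeasure (α i) 1).map sumSqDev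

section Law

variable {n : ℕ} {α : Fin n → ℝ}

lemma isProbabilityMeasure_sumSqDevLaw (hα : ∀ i, 0 < α i) :
    IsProbabilityMeasure (sumSqDevLaw α) := by
  have : ∀ i, IsProbabilityMeasure (gammaMeasure (α i) 1) := fun i =>
    isProbabilityMeasure_gammaMeasure (hα i) one_pos
  exact Measure.isProbabilityMeasure_map measurable_sumSqDev.aemeasurable

lemma ae_sumSqDevLaw_nonneg : ∀ᵐ q ∂sumSqDevLaw α, 0 ≤ q := by
  rw [sumSqDevLaw, ae_map_iff measurable_sumSqDev.aemeasurable measurableSet_Ici]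
  exact ae_of_all _ sumSqDev_nonneg

lemma lintegral_sumSqDevLaw {f : ℝ → ENNReal} (hf : Measurable f) :
    ∫⁻ q, f q ∂sumSqDevLaw α = ∫⁻ y, f (sumSqDev y) ∂Measure.pi fun i => gammaMeasure (α i) 1 :=
  lintegral_map hf measurable_sumSqDev

/-- The Laplace transform of the law decays like a power of `t`; the exponent is smaller than half
the sum of the shapes. -/
lemma exists_lintegral_sumSqDevLaw_le (hn : 2 ≤ n) (hα : ∀ i, 0 < α i) :
    ∃ C ε : ℝ, 0 ≤ C ∧ 0 < ε ∧ ε ≤ (∑ i, α i) / 2 ∧ ∀ t : ℝ, 0 < t →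
      ∫⁻ q, ENNReal.ofReal (Real.exp (-(t * q))) ∂sumSqDevLaw α ≤
        ENNReal.ofReal (C * t ^ (-ε)) := by
  let i : Fin n := ⟨0, by omega⟩
  let j : Fin n := ⟨1, by omega⟩
  have hij : i ≠ j := by simp [i, j]
  obtain ⟨C, hC, h⟩ := exists_lintegral_exp_neg_sumSqDev_le hα hij
  have hi := hα i
  have hsum : α i ≤ ∑ i, α i :=
    Finset.single_le_sum (fun k _ => (hα k).le) (Finset.mem_univ i)
  refine ⟨C, α i / (2 * (1 + α i)), hC, by positivity, ?_, fun t ht => ?_⟩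
  · refine le_trans ?_ (div_le_div_of_nonneg_right hsum two_pos.le)
    gcongr
    linarith
  · rw [lintegral_sumSqDevLaw (by fun_prop)]
    exact h t ht

/-- The law has no atom at `0`, as `P(Q ≤ 0) ≤ E exp(-tQ)` tends to `0` as `t → ∞`. -/
lemma cdf_sumSqDevLaw_of_nonpos (hn : 2 ≤ n) (hα : ∀ i, 0 < α i) {x : ℝ} (hx : x ≤ 0) :
    cdf (sumSqDevLaw α) x = 0 := by
  have := isProbabilityMeasure_sumSqDevLaw hα
  obtain ⟨C, ε, hC, hε, -, h⟩ := exists_lintegral_sumSqDevLaw_le hn hα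
  refine le_antisymm ?_ (cdf_nonneg _ x)
  have hlim : Tendsto (fun t : ℝ => C * t ^ (-ε)) atTop (𝓝 0) := by
    simpa using (tendsto_rpow_neg_atTop hε).const_mul C
  refine ge_of_tendsto hlim ?_
  filter_upwards [eventually_gt_atTop 0] with t ht
  have h0 : 0 ≤ C * t ^ (-ε) := by positivity
  rw [← ENNReal.ofReal_le_ofReal_iff h0, ofReal_cdf]
  refine le_trans ?_ (h t ht)
  rw [← setLIntegral_one]
  refine (setLIntegral_mono (by fun_prop) fun q hq => ?_).trans (setLIntegral_le_lintegral _ _)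
  have hq0 : q ≤ 0 := le_trans hq hx
  rw [ENNReal.one_le_ofReal, Real.one_le_exp_iff]
  nlinarith

lemma lintegral_sumSqDevLaw_eq (hn : n ≠ 0) (hα : ∀ i, 0 < α i) {t : ℝ} (ht : 0 < t) :
    ∫⁻ q, ENNReal.ofReal (Real.exp (-(t * q))) ∂sumSqDevLaw α =
      ENNReal.ofReal (t ^ (-((∑ i, α i) / 2))) * ∫⁻ z, ENNReal.ofReal (gammaWeight α z *
        Real.exp (-(z * (Real.sqrt (n / 2) / Real.sqrt t)) -
          (Real.sqrt (n / 2) / Real.sqrt t) ^ 2 / 2)) := by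
  rw [lintegral_sumSqDevLaw (by fun_prop), lintegral_exp_neg_sumSqDev hn hα ht]

lemma lintegral_kernelMajorant_mul_gammaWeight_lt_top (hn : 2 ≤ n) (hα : ∀ i, 0 < α i) :
    ∫⁻ z, kernelMajorant ((∑ i, α i) / 2 + 1) (Real.sqrt (n / 2)) z *
      ENNReal.ofReal (gammaWeight α z) < ⊤ := by
  obtain ⟨C, ε, hC, hε, hεα, h⟩ := exists_lintegral_sumSqDevLaw_le hn hα
  refine lintegral_kernelMajorant_mul_lt_top hε (by linarith) hC (measurable_gammaWeight α)
    (gammaWeight_nonneg hα) fun t ht => ?_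
  have h1 := h t ht
  rw [lintegral_sumSqDevLaw_eq (by omega) hα ht] at h1
  have h2 := mul_le_mul_right h1 (ENNReal.ofReal (t ^ ((∑ i, α i) / 2)))
  rw [← mul_assoc, ← ENNReal.ofReal_mul (by positivity), ← Real.rpow_add ht, add_neg_cancel,
    Real.rpow_zero, ENNReal.ofReal_one, one_mul, ← ENNReal.ofReal_mul (by positivity)] at h2
  refine h2.trans (le_of_eq ?_)
  rw [add_sub_cancel_right, sub_eq_add_neg, Real.rpow_add ht]
  congr 1
  ring

/-- Both sides have the same Laplace transform on `t > 1`. -/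
lemma cdf_sumSqDevLaw_eq_kernelTransform (hn : 2 ≤ n) (hα : ∀ i, 0 < α i) {x : ℝ} (hx : 0 < x) :
    cdf (sumSqDevLaw α) x = kernelTransform ((∑ i, α i) / 2 + 1) (Real.sqrt (n / 2))
      (gammaWeight α) x := by
  have := isProbabilityMeasure_sumSqDevLaw hα
  have hfin := lintegral_kernelMajorant_mul_gammaWeight_lt_top hn hα
  have hsum : 0 < ∑ i, α i :=
    Finset.sum_pos (fun i _ => hα i) ⟨⟨0, by omega⟩, Finset.mem_univ _⟩
  set A := (∑ i, α i) / 2 with hA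
  have hβ : 1 < A + 1 := by linarith
  have hκ := Real.sqrt_nonneg ((n : ℝ) / 2)
  have hw := measurable_gammaWeight α
  have hw0 := gammaWeight_nonneg hα
  refine cdf_eq_of_ae_eq (continuousOn_kernelTransform hβ hκ hw hw0 hfin) ?_ hx
  refine ae_eq_of_forall_integral_exp_mul_eq (c := 1)
    (fun t ht => integrableOn_exp_mul_cdf _ (by linarith))
    (fun t ht => integrableOn_exp_mul_kernelTransform hβ hκ hw hw0 hfin ht) fun t ht => ?_
  have ht0 : 0 < t := by linarith
  rw [integral_exp_mul_kernelTransform hβ hκ hw hw0 hfin ht,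
    integral_eq_lintegral_of_nonneg_ae
      (ae_of_all _ fun x => mul_nonneg (Real.exp_pos _).le (cdf_nonneg _ x))
      (integrableOn_exp_mul_cdf _ ht0).aestronglyMeasurable,
    integral_eq_lintegral_of_nonneg_ae
      (ae_of_all _ fun z => mul_nonneg (hw0 z) (Real.exp_pos _).le)
      (hw.mul (by fun_prop)).aestronglyMeasurable,
    lintegral_exp_mul_cdf ae_sumSqDevLaw_nonneg ht0,
    lintegral_sumSqDevLaw_eq (by omega) hα ht0, ← mul_assoc,
    ← ENNReal.ofReal_mul (by positivity), ENNReal.toReal_mul,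
    ENNReal.toReal_ofReal (by positivity), neg_add, Real.rpow_add ht0, Real.rpow_neg_one]
  ring

end Law

/-- The distribution function of `∑ (Xᵢ - X̄)²` for independent gamma variables. -/
lemma sampleQ_gamma_cdf {n : ℕ} (hn : 2 ≤ n) {α : Fin n → ℝ} (hα : ∀ i, 0 < α i)
    {Ω : Type*} [MeasurableSpace Ω] (P : Measure Ω) [IsProbabilityMeasure P]
    (X : Fin n → Ω → ℝ) (hind : iIndepFun X P) (hX : ∀ i, HasLaw (X i) (gammaMeasure (α i) 1) P) :
    (∀ x : ℝ, x ≤ 0 → P.real {ω | sampleQ X ω ≤ x} = 0) ∧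
    (∀ x : ℝ, 0 < x →
      Integrable (fun z : ℝ => kernelK ((∑ i, α i) / 2 + 1) (Real.sqrt (n * x / 2)) z *
        (∏ i, gammaM (α i) (Real.sqrt (2 / n) * z)) * gaussianPDFReal 0 1 z) ∧
      P.real {ω | sampleQ X ω ≤ x} = x ^ ((∑ i, α i) / 2) *
        ∫ z : ℝ, kernelK ((∑ i, α i) / 2 + 1) (Real.sqrt (n * x / 2)) z *
          (∏ i, gammaM (α i) (Real.sqrt (2 / n) * z)) * gaussianPDFReal 0 1 z) := by
  have := isProbabilityMeasure_sumSqDevLaw hα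
  have hcdf : ∀ x, P.real {ω | sampleQ X ω ≤ x} = cdf (sumSqDevLaw α) x := by
    intro x
    rw [cdf_eq_real, sumSqDevLaw, map_measureReal_apply measurable_sumSqDev measurableSet_Iic]
    exact (hind.hasLaw_pi hX).measureReal_eq (p := fun y => sumSqDev y ≤ x)
      (measurable_sumSqDev measurableSet_Iic)
  refine ⟨fun x hx => by rw [hcdf, cdf_sumSqDevLaw_of_nonpos hn hα hx], fun x hx => ?_⟩
  have hsum : 0 < ∑ i, α i :=
    Finset.sum_pos (fun i _ => hα i) ⟨⟨0, by omega⟩, Finset.mem_univ _⟩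
  have hxA : 0 < x ^ ((∑ i, α i) / 2) := Real.rpow_pos_of_pos hx _
  have heq : ∀ z, x ^ ((∑ i, α i) / 2 + 1 - 1) *
      kernelK ((∑ i, α i) / 2 + 1) (Real.sqrt (n / 2) * Real.sqrt x) z * gammaWeight α z =
      x ^ ((∑ i, α i) / 2) * (kernelK ((∑ i, α i) / 2 + 1) (Real.sqrt (n * x / 2)) z *
        (∏ i, gammaM (α i) (Real.sqrt (2 / n) * z)) * gaussianPDFReal 0 1 z) := by
    intro z
    rw [add_sub_cancel_right, ← Real.sqrt_mul (by positivity), div_mul_eq_mul_div, gammaWeight]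
    ring
  constructor
  · have hint := integrable_kernelK_mul (by linarith) (Real.sqrt_nonneg _)
      (measurable_gammaWeight α) (gammaWeight_nonneg hα)
      (lintegral_kernelMajorant_mul_gammaWeight_lt_top hn hα) hx
    simp_rw [heq] at hint
    exact (integrable_const_mul_iff hxA.ne'.isUnit _).1 hint
  · rw [hcdf, cdf_sumSqDevLaw_eq_kernelTransform hn hα hx, kernelTransform,
      ← integral_const_mul]
    simp_rw [heq]

theorem theorem2 :
    -- `M_α`: the defining integral converges, and `M_α` has a power series and a `₁F₁` form
    (∀ α : ℝ, 0 < α → ∀ z : ℝ,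
      IntegrableOn (fun x : ℝ => Real.exp (-x ^ 2) * x ^ (α - 1) * Real.exp (x * z))
        (Set.Ioi 0) ∧
      HasSum (fun k : ℕ => (2 * Real.Gamma α)⁻¹ * (Real.Gamma ((α + k) / 2) * z ^ k / (k ! : ℝ)))
        (gammaM α z) ∧
      gammaM α z = (2 * Real.Gamma α)⁻¹ *
        (Real.Gamma (α / 2) * kummer (α / 2) (1 / 2) (z ^ 2 / 4) +
          Real.Gamma ((α + 1) / 2) * z * kummer ((α + 1) / 2) (3 / 2) (z ^ 2 / 4))) ∧
    -- `K_β`: the defining series converges absolutely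
    (∀ β : ℝ, 0 < β → ∀ r : ℝ, 0 ≤ r → ∀ z : ℝ, Summable (fun k : ℕ => |kernelTerm β r z k|)) ∧
    -- the cdf for i.i.d. gamma variables
    (∀ (n : ℕ), 2 ≤ n → ∀ (α : ℝ), 0 < α →
      ∀ {Ω : Type*} [MeasurableSpace Ω] (P : Measure Ω) [IsProbabilityMeasure P]
        (X : Fin n → Ω → ℝ), iIndepFun X P → (∀ i, HasLaw (X i) (gammaMeasure α 1) P) →
      (∀ x : ℝ, x ≤ 0 → P.real {ω | sampleQ X ω ≤ x} = 0) ∧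
      (∀ x : ℝ, 0 < x →
        Integrable (fun z : ℝ => kernelK (α * n / 2 + 1) (Real.sqrt (n * x / 2)) z *
          gammaM α (Real.sqrt (2 / n) * z) ^ n * gaussianPDFReal 0 1 z) ∧
        P.real {ω | sampleQ X ω ≤ x} = x ^ (α * n / 2) *
          ∫ z : ℝ, kernelK (α * n / 2 + 1) (Real.sqrt (n * x / 2)) z *
            gammaM α (Real.sqrt (2 / n) * z) ^ n * gaussianPDFReal 0 1 z)) ∧
    -- the cdf for independent gamma variables with different shape parameters
    (∀ (n : ℕ), 2 ≤ n → ∀ (α : Fin n → ℝ), (∀ i, 0 < α i) →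
      ∀ {Ω : Type*} [MeasurableSpace Ω] (P : Measure Ω) [IsProbabilityMeasure P]
        (X : Fin n → Ω → ℝ), iIndepFun X P → (∀ i, HasLaw (X i) (gammaMeasure (α i) 1) P) →
      (∀ x : ℝ, x ≤ 0 → P.real {ω | sampleQ X ω ≤ x} = 0) ∧
      (∀ x : ℝ, 0 < x →
        Integrable (fun z : ℝ => kernelK ((∑ i, α i) / 2 + 1) (Real.sqrt (n * x / 2)) z *
          (∏ i, gammaM (α i) (Real.sqrt (2 / n) * z)) * gaussianPDFReal 0 1 z) ∧
        P.real {ω | sampleQ X ω ≤ x} = x ^ ((∑ i, α i) / 2) *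
          ∫ z : ℝ, kernelK ((∑ i, α i) / 2 + 1) (Real.sqrt (n * x / 2)) z *
            (∏ i, gammaM (α i) (Real.sqrt (2 / n) * z)) * gaussianPDFReal 0 1 z)) := by
  refine ⟨fun α hα z => ⟨integrableOn_gammaM_integrand hα z, hasSum_gammaM hα z,
    gammaM_eq_kummer hα z⟩, fun β hβ r hr z => summable_abs_kernelTerm hβ hr z, ?_, ?_⟩
  · intro n hn α hα Ω _ P _ X hind hX
    have h := sampleQ_gamma_cdf hn (α := fun _ => α) (fun _ => hα) P X hind hX
    simpa only [Finset.sum_const, Finset.prod_const, Finset.card_univ, Fintype.card_fin,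
      nsmul_eq_mul, mul_comm (n : ℝ) α] using h
  · intro n hn α hα Ω _ P _ X hind hX
    exact sampleQ_gamma_cdf hn hα P X hind hX
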